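/- Let $\alpha,b\in\mathbb{R}$, $a>0$, $\sigma>0$, $0<r_{\min}<r_{\max}<\infty$, $\xi_2>0$, and let $\Omega=(r_{\min},r_{\max})\times(0,2\pi)$ with variables $(r,\psi)$. Put $$f(r)=\alpha r-ar^3+\frac{\sigma^2}{2r},\qquad g(r,\psi)=2r^2\left(b+\sqrt{a^2+b^2}\cos\psi\right),$$ $$\tilde\nabla u=\left(\partial_r u,\ \tfrac{2}{r}\partial_\psi u\right),\qquad \tilde\Delta u=\partial_r^2u+\tfrac{4}{r^2}\partial_\psi^2u,\qquad Lu=\tfrac{\sigma^2}{2}\tilde\Delta u+f\,\partial_r u+g\,\partial_\psi u .$$ Let $Y=L^2(\Omega;\mathbb{C})$ with $$\langle u_1,u_2\rangle_{L^2}=\frac{1}{2\pi(r_{\max}-r_{\min})}\int_\Omega u_1\,\overline{u_2}\,dr\,d\psi .$$ Let $X$ be the space of complex-valued $H^2$ functions on the cylinder $(r_{\min},r_{\max})\times(\mathbb{R}/2\pi\mathbb{Z})$ that vanish at $r=r_{\min}$ and $r=r_{\max}$ (that is, the functions $u\in H^2(\Omega)$ which vanish there and for which both $u$ and $\partial_\psi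 u$ take the same values at $\psi=0$ and at $\psi=2\pi$), with the inner product $$\langle u_1,u_2\rangle_X=\langle u_1,u_2\rangle_{L^2}+\langle\tilde\nabla u_1,\tilde\nabla u_2\rangle_{L^2}+\xi_2\langle\tilde\Delta u_1,\tilde\Delta u_2\rangle_{L^2}.$$ Let $\mathcal{X}=X\times\mathbb{C}$ and $\mathcal{Y}=Y\times\mathbb{C}$ with $\|(u,\lambda)\|^2=\|u\|^2+|\lambda|^2$. Fix $(\bar u,\bar\lambda)\in\mathcal{X}$ and let $\mathcal{F}:\mathcal{X}\to\mathcal{Y}$ be $$\mathcal{F}(u,\lambda)=\left(Lu-\lambda u,\ \langle u,\bar u\rangle_{L^2}-1\right).$$ Assume that there are constants $\delta,\kappa,\gamma\ge0$ such that, for all $x,x_1,x_2\in\mathcal{X}$, $$\|\mathcal{F}(\bar u,\bar\lambda)\|_{\mathcal{Y}}\le\delta,\qquad \|x\|_{\mathcal{X}}\le\kappa\,\|\mathcal{F}'(\bar u,\bar\lambda)[x]\|_{\mathcal{Y}},\qquad \|\mathcal{F}''(\bar u,\bar\lambda)[x_1,x_2]\|_{\mathcal{Y}}\le\gamma\,\|x_1\|_{\mathcal{X}}\|x_2\|_{\mathcal{X}},$$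 where $\mathcal{F}'$ and $\mathcal{F}''$ are Fréchet derivatives, and that $2\kappa^2\gamma\delta<1$. Assume in addition that $\bar u$ does not depend on $\psi$. Then, for every $\rho$ with $$\frac{1-\sqrt{1-2\kappa^2\gamma\delta}}{\kappa\gamma}\le\rho<\frac{1}{\kappa\gamma},$$ $\mathcal{F}$ has exactly one zero $(u,\lambda)\in\mathcal{X}$ with $\|(u,\lambda)-(\bar u,\bar\lambda)\|_{\mathcal{X}}\le\rho$, and for this zero $u$ does not depend on $\psi$. -/

import Mathlib

open MeasureTheory Set Filter Topology
open scoped ContDiff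

namespace ShearHopf

/-- The parameters: coefficients of the stochastic Hopf system, inner and outer radius of the
annulus, and the weight `ξ₂` in the inner product of the solution space. -/
structure Params where
  α : ℝ
  a : ℝ
  b : ℝ
  σ : ℝ
  rmin : ℝ
  rmax : ℝ
  ξ₂ : ℝ
  a_pos : 0 < a
  σ_pos : 0 < σ
  rmin_pos : 0 < rmin
  rmin_lt_rmax : rmin < rmax
  ξ₂_pos : 0 < ξ₂

variable (P : Params)

/-! ### The domain and the coefficients -/

/-- The domain `Ω = (rmin, rmax) × (0, 2π)`; a point is `x = (r, ψ)`. -/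
def Params.Ω : Set (ℝ × ℝ) := Ioo P.rmin P.rmax ×ˢ Ioo 0 (2 * Real.pi)

/-- The closed rectangle `[rmin, rmax] × [0, 2π]`. -/
def Params.Ωbar : Set (ℝ × ℝ) := Icc P.rmin P.rmax ×ˢ Icc 0 (2 * Real.pi)

/-- The drift `f(r) = α r - a r³ + σ² / (2 r)`. -/
noncomputable def Params.f (x : ℝ × ℝ) : ℝ :=
  P.α * x.1 - P.a * x.1 ^ 3 + P.σ ^ 2 / (2 * x.1)

/-- The drift `g(r, ψ) = 2 r² (b + √(a² + b²) cos ψ)`. -/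
noncomputable def Params.g (x : ℝ × ℝ) : ℝ :=
  2 * x.1 ^ 2 * (P.b + √(P.a ^ 2 + P.b ^ 2) * Real.cos x.2)

/-- The coefficient `2 / r` of `∂_ψ` in the modified gradient. -/
noncomputable def cGrad (x : ℝ × ℝ) : ℝ := 2 / x.1

/-- The coefficient `4 / r²` of `∂_ψ²` in the modified Laplacian. -/
noncomputable def cLap (x : ℝ × ℝ) : ℝ := 4 / x.1 ^ 2

variable {P}

lemma Params.ne_zero_of_mem {x : ℝ × ℝ} (hx : x ∈ P.Ωbar) : x.1 ≠ 0 :=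
  (P.rmin_pos.trans_le hx.1.1).ne'

lemma Params.continuousOn_f : ContinuousOn P.f P.Ωbar := by
  unfold Params.f
  refine ContinuousOn.add (by fun_prop) (ContinuousOn.div (by fun_prop) (by fun_prop) ?_)
  intro x hx
  simpa using P.ne_zero_of_mem hx

lemma Params.continuousOn_g : ContinuousOn P.g P.Ωbar := by
  unfold Params.g
  fun_prop

lemma Params.continuousOn_cGrad : ContinuousOn cGrad P.Ωbar := by
  unfold cGrad
  exact ContinuousOn.div (by fun_prop) (by fun_prop) fun x hx => P.ne_zero_of_mem hx

lemma Params.continuousOn_cLap : ContinuousOn cLap P.Ωbar := by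
  unfold cLap
  refine ContinuousOn.div (by fun_prop) (by fun_prop) fun x hx => ?_
  simpa using P.ne_zero_of_mem hx

variable (P)

/-! ### The space `L²` -/

/-- Lebesgue measure on `Ω`, normalised by the factor `1 / (2π (rmax - rmin))`. -/
noncomputable def Params.μ : Measure (ℝ × ℝ) :=
  ENNReal.ofReal (1 / (2 * Real.pi * (P.rmax - P.rmin))) • volume.restrict P.Ω

/-- The space `Y = L²(Ω; ℂ)` with `‖u‖² = 1 / (2π (rmax - rmin)) ∫_Ω |u|² dr dψ`. -/
noncomputable abbrev L2 := Lp ℂ 2 P.μ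

variable {P}

lemma Params.measurableSet_Ω : MeasurableSet P.Ω := measurableSet_Ioo.prod measurableSet_Ioo

lemma Params.isOpen_Ω : IsOpen P.Ω := isOpen_Ioo.prod isOpen_Ioo

lemma Params.isCompact_Ωbar : IsCompact P.Ωbar := isCompact_Icc.prod isCompact_Icc

lemma Params.Ω_subset : P.Ω ⊆ P.Ωbar := prod_mono Ioo_subset_Icc_self Ioo_subset_Icc_self

instance : IsFiniteMeasure P.μ := by
  have h : volume P.Ω < ⊤ := (measure_mono P.Ω_subset).trans_lt P.isCompact_Ωbar.measure_lt_top
  have : IsFiniteMeasure (volume.restrict P.Ω) := ⟨by simpa using h⟩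
  exact Measure.smul_finite _ ENNReal.ofReal_ne_top

lemma Params.scale_pos : 0 < 1 / (2 * Real.pi * (P.rmax - P.rmin)) := by
  have := sub_pos.2 P.rmin_lt_rmax
  positivity

lemma Params.μ_ac : P.μ ≪ volume.restrict P.Ω := Measure.smul_absolutelyContinuous

lemma Params.ac_μ : volume.restrict P.Ω ≪ P.μ :=
  Measure.absolutelyContinuous_smul (ENNReal.ofReal_pos.2 P.scale_pos).ne'

lemma Params.ae_mem : ∀ᵐ x ∂P.μ, x ∈ P.Ω :=
  P.μ_ac.ae_le (ae_restrict_mem P.measurableSet_Ω)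

lemma memLp_mul {c : ℝ × ℝ → ℝ} (hc : ContinuousOn c P.Ωbar) (u : L2 P) :
    MemLp (fun x => (c x : ℂ) * u x) 2 P.μ := by
  obtain ⟨C, hC⟩ := P.isCompact_Ωbar.exists_bound_of_continuousOn hc
  have hm : AEStronglyMeasurable (fun x => (c x : ℂ)) P.μ := by
    have h1 : AEStronglyMeasurable (fun x => (c x : ℂ)) (volume.restrict P.Ω) :=
      (Complex.continuous_ofReal.comp_continuousOn (hc.mono P.Ω_subset)).aestronglyMeasurable
        P.measurableSet_Ω
    exact h1.mono_ac P.μ_ac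
  have hb : MemLp (fun x => (c x : ℂ)) ⊤ P.μ := by
    refine memLp_top_of_bound hm C ?_
    filter_upwards [P.ae_mem] with x hx
    simpa using hC x (P.Ω_subset hx)
  exact (Lp.memLp u).mul' hb

/-- Multiplication of `L²` functions by a coefficient that is continuous on the closed rectangle. -/
noncomputable def mulL2 (c : ℝ × ℝ → ℝ) (hc : ContinuousOn c P.Ωbar) : L2 P →ₗ[ℂ] L2 P where
  toFun u := (memLp_mul hc u).toLp
  map_add' u v := by
    refine Lp.ext ?_
    filter_upwards [(memLp_mul hc (u + v)).coeFn_toLp, (memLp_mul hc u).coeFn_toLp,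
      (memLp_mul hc v).coeFn_toLp, Lp.coeFn_add u v,
      Lp.coeFn_add (memLp_mul hc u).toLp (memLp_mul hc v).toLp] with x h1 h2 h3 h4 h5
    rw [h1, h5, Pi.add_apply, h2, h3, h4, Pi.add_apply, mul_add]
  map_smul' z u := by
    refine Lp.ext ?_
    filter_upwards [(memLp_mul hc (z • u)).coeFn_toLp, (memLp_mul hc u).coeFn_toLp,
      Lp.coeFn_smul z u, Lp.coeFn_smul z (memLp_mul hc u).toLp] with x h1 h2 h3 h4
    rw [RingHom.id_apply, h1, h4, Pi.smul_apply, h2, h3, Pi.smul_apply, smul_eq_mul, smul_eq_mul]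
    ring

/-! ### Weak derivatives on the cylinder -/

variable (P)

/-- Test functions on the open cylinder `(rmin, rmax) × (ℝ / 2πℤ)`: smooth functions of `(r, ψ)`
which are `2π`-periodic in `ψ` and vanish for `r` outside a compact subset of `(rmin, rmax)`. -/
structure IsTest (φ : ℝ × ℝ → ℝ) : Prop where
  smooth : ContDiff ℝ ∞ φ
  periodic : ∀ r ψ, φ (r, ψ + 2 * Real.pi) = φ (r, ψ)
  support : ∃ K ⊆ Ioo P.rmin P.rmax, IsCompact K ∧ ∀ r ψ, r ∉ K → φ (r, ψ) = 0

variable {P}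

/-- `v` is the weak derivative of `u` in the direction `e` on the cylinder. (Integrating with
respect to the normalised measure multiplies both sides by the same constant.) -/
def IsWeakDeriv (e : ℝ × ℝ) (u v : L2 P) : Prop :=
  ∀ φ, IsTest P φ → ∫ x, u x * (fderiv ℝ φ x e : ℝ) ∂P.μ = -∫ x, v x * (φ x : ℝ) ∂P.μ

/-- The direction of `r`. -/
def er : ℝ × ℝ := (1, 0)

/-- The direction of `ψ`. -/
def eψ : ℝ × ℝ := (0, 1)

/-- The weak derivative in the direction `e` (zero if there is none). -/
noncomputable def wderiv (e : ℝ × ℝ) (u : L2 P) : L2 P :=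
  open Classical in if h : ∃ v, IsWeakDeriv e u v then h.choose else 0

/-- Both first weak derivatives exist in `L²`. -/
def MemH1 (u : L2 P) : Prop := (∃ v, IsWeakDeriv er u v) ∧ ∃ v, IsWeakDeriv eψ u v

/-- The Sobolev space `H²` of the cylinder: all weak derivatives of order at most two exist
in `L²`. -/
def MemH2 (u : L2 P) : Prop := MemH1 u ∧ MemH1 (wderiv er u) ∧ MemH1 (wderiv eψ u)

/-- A smooth function with compact support in `Ω` agrees on `Ω` with a test function. -/
lemma exists_isTest_eqOn {φ : ℝ × ℝ → ℝ} (h1 : ContDiff ℝ ∞ φ) (h2 : HasCompactSupport φ)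
    (h3 : tsupport φ ⊆ P.Ω) : ∃ φ', IsTest P φ' ∧ EqOn φ' φ P.Ω := by
  have hp : 0 < 2 * Real.pi := Real.two_pi_pos
  refine ⟨fun x => φ (x.1, toIcoMod hp 0 x.2), ⟨?_, ?_, ?_⟩, ?_⟩
  · rw [contDiff_iff_contDiffAt]
    intro x
    set m : ℤ := toIcoDiv hp 0 x.2 with hm
    have hs := sub_toIcoDiv_zsmul_mem_Ico hp 0 x.2
    rw [← hm, zero_add] at hs
    have hc : ContinuousAt (fun y : ℝ × ℝ => y.2 - m • (2 * Real.pi)) x := by fun_prop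
    rcases hs.1.eq_or_lt with h0 | h0
    · have hz : ∀ s : ℝ, s ∉ Ioo 0 (2 * Real.pi) → ∀ᶠ y in 𝓝 (x.1, s), φ y = 0 := by
        intro s hs
        have : (x.1, s) ∉ tsupport φ := fun h => hs (h3 h).2
        filter_upwards [(isClosed_tsupport φ).isOpen_compl.mem_nhds this] with y hy
        exact image_eq_zero_of_notMem_tsupport hy
      have t1 : Tendsto (fun y : ℝ × ℝ => (y.1, y.2 - m • (2 * Real.pi))) (𝓝 x)
          (𝓝 (x.1, 0)) := by
        have : ContinuousAt (fun y : ℝ × ℝ => (y.1, y.2 - m • (2 * Real.pi))) x := by fun_prop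
        simpa only [ContinuousAt, ← h0] using this
      have t2 : Tendsto (fun y : ℝ × ℝ => (y.1, y.2 - (m - 1) • (2 * Real.pi))) (𝓝 x)
          (𝓝 (x.1, 2 * Real.pi)) := by
        have : ContinuousAt (fun y : ℝ × ℝ => (y.1, y.2 - (m - 1) • (2 * Real.pi))) x := by
          fun_prop
        have e : x.2 - (m - 1) • (2 * Real.pi) = 2 * Real.pi := by
          rw [sub_smul, one_smul]; linarith
        simpa only [ContinuousAt, e] using this
      have hm1 : Tendsto (fun y : ℝ × ℝ => y.2 - m • (2 * Real.pi)) (𝓝 x) (𝓝 0) := by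
        simpa only [ContinuousAt, ← h0] using hc
      refine (contDiffAt_const (c := (0 : ℝ))).congr_of_eventuallyEq ?_
      filter_upwards [t1 (hz 0 (by simp)), t2 (hz (2 * Real.pi) (by simp)),
        hm1 (Ioo_mem_nhds (neg_lt_zero.2 hp) hp)] with y y1 y2 y3
      simp only [mem_preimage, mem_Ioo] at y1 y2 y3
      rcases le_or_gt 0 (y.2 - m • (2 * Real.pi)) with h | h
      · have : toIcoMod hp 0 y.2 = y.2 - m • (2 * Real.pi) := by
          rw [toIcoMod, toIcoDiv_eq_of_sub_zsmul_mem_Ico hp ⟨h, by simpa using y3.2⟩]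
        rw [this]; exact y1
      · have : toIcoMod hp 0 y.2 = y.2 - (m - 1) • (2 * Real.pi) := by
          rw [toIcoMod, toIcoDiv_eq_of_sub_zsmul_mem_Ico hp]
          rw [sub_smul, one_smul]
          constructor <;> linarith [y3.1]
        rw [this]; exact y2
    · have : ContDiffAt ℝ ∞ (fun y : ℝ × ℝ => φ (y.1, y.2 - m • (2 * Real.pi))) x :=
        (h1.comp (by fun_prop : ContDiff ℝ ∞
          fun y : ℝ × ℝ => (y.1, y.2 - m • (2 * Real.pi)))).contDiffAt
      refine this.congr_of_eventuallyEq ?_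
      filter_upwards [hc (Ioo_mem_nhds h0 hs.2)] with y hy
      have : toIcoMod hp 0 y.2 = y.2 - m • (2 * Real.pi) := by
        rw [toIcoMod, toIcoDiv_eq_of_sub_zsmul_mem_Ico hp ⟨hy.1.le, by simpa using hy.2⟩]
      rw [this]
  · intro r ψ
    simp
  · refine ⟨Prod.fst '' tsupport φ, ?_, h2.isCompact.image continuous_fst, ?_⟩
    · rintro _ ⟨y, hy, rfl⟩
      exact (h3 hy).1
    · intro r ψ hr
      exact image_eq_zero_of_notMem_tsupport fun h => hr ⟨_, h, rfl⟩
  · intro x hx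
    have : toIcoMod hp 0 x.2 = x.2 :=
      (toIcoMod_eq_self hp).2 ⟨hx.2.1.le, by simpa using hx.2.2⟩
    simp [this]

lemma integrable_mul_of_test (u : L2 P) {c : ℝ × ℝ → ℝ} (hc : Continuous c) :
    Integrable (fun x => u x * (c x : ℂ)) P.μ := by
  have := (memLp_mul hc.continuousOn u).integrable (by norm_num)
  simpa only [mul_comm] using this

lemma IsTest.continuous_fderiv {φ : ℝ × ℝ → ℝ} (h : IsTest P φ) (e : ℝ × ℝ) :
    Continuous fun x => fderiv ℝ φ x e :=
  (h.smooth.continuous_fderiv (by simp)).clm_apply continuous_const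

/-- An `L²` function which integrates to zero against all test functions vanishes. -/
lemma eq_zero_of_forall_test (w : L2 P)
    (h : ∀ φ, IsTest P φ → ∫ x, w x * (φ x : ℝ) ∂P.μ = 0) : w = 0 := by
  have hi : IntegrableOn w P.Ω volume := by
    have h1 : Integrable w P.μ := (Lp.memLp w).integrable (by norm_num)
    unfold Params.μ at h1
    exact (integrable_smul_measure (ENNReal.ofReal_pos.2 P.scale_pos).ne'
      ENNReal.ofReal_ne_top).1 h1
  have h0 : ∀ᵐ x ∂(volume : Measure (ℝ × ℝ)), x ∈ P.Ω → w x = 0 := by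
    refine P.isOpen_Ω.ae_eq_zero_of_integral_contDiff_smul_eq_zero hi.locallyIntegrableOn ?_
    intro φ h1 h2 h3
    obtain ⟨φ', t, ht⟩ := exists_isTest_eqOn h1 h2 h3
    have h4 := h φ' t
    unfold Params.μ at h4
    rw [integral_smul_measure, ENNReal.toReal_ofReal P.scale_pos.le] at h4
    have h5 := (smul_eq_zero.1 h4).resolve_left P.scale_pos.ne'
    rw [← setIntegral_eq_integral_of_forall_compl_eq_zero (s := P.Ω)]
    · rw [← h5]
      refine setIntegral_congr_fun P.measurableSet_Ω fun x hx => ?_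
      rw [Complex.real_smul, ht hx]
      exact mul_comm _ _
    · intro x hx
      rw [image_eq_zero_of_notMem_tsupport fun h => hx (h3 h), zero_smul]
  refine Lp.ext ?_
  have h1 : ∀ᵐ x ∂P.μ, w x = 0 :=
    P.μ_ac.ae_le ((ae_restrict_iff' P.measurableSet_Ω).2 h0)
  filter_upwards [h1, Lp.coeFn_zero ℂ 2 P.μ] with x hx hx'
  rw [hx, hx', Pi.zero_apply]

lemma IsWeakDeriv.unique {e : ℝ × ℝ} {u v w : L2 P} (hv : IsWeakDeriv e u v)
    (hw : IsWeakDeriv e u w) : v = w := by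
  refine sub_eq_zero.1 (eq_zero_of_forall_test _ fun φ hφ => ?_)
  have h1 : ∫ x, (v - w) x * (φ x : ℝ) ∂P.μ = ∫ x, (v x * (φ x : ℝ) - w x * (φ x : ℝ)) ∂P.μ := by
    refine integral_congr_ae ?_
    filter_upwards [Lp.coeFn_sub v w] with x hx
    rw [hx, Pi.sub_apply, sub_mul]
  rw [h1, integral_sub (integrable_mul_of_test v hφ.smooth.continuous)
    (integrable_mul_of_test w hφ.smooth.continuous), sub_eq_zero]
  exact neg_injective ((hv φ hφ).symm.trans (hw φ hφ))

lemma IsWeakDeriv.add {e : ℝ × ℝ} {u₁ u₂ v₁ v₂ : L2 P} (h₁ : IsWeakDeriv e u₁ v₁)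
    (h₂ : IsWeakDeriv e u₂ v₂) : IsWeakDeriv e (u₁ + u₂) (v₁ + v₂) := by
  have key : ∀ (p q : L2 P) (c : ℝ × ℝ → ℝ), Continuous c →
      ∫ x, (p + q) x * (c x : ℝ) ∂P.μ
        = ∫ x, p x * (c x : ℝ) ∂P.μ + ∫ x, q x * (c x : ℝ) ∂P.μ := by
    intro p q c hc
    rw [← integral_add (integrable_mul_of_test p hc) (integrable_mul_of_test q hc)]
    refine integral_congr_ae ?_
    filter_upwards [Lp.coeFn_add p q] with x hx
    rw [hx, Pi.add_apply, add_mul]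
  intro φ hφ
  rw [key _ _ _ (hφ.continuous_fderiv e), key _ _ _ hφ.smooth.continuous, h₁ φ hφ, h₂ φ hφ,
    neg_add]

lemma IsWeakDeriv.smul {e : ℝ × ℝ} {u v : L2 P} (z : ℂ) (h : IsWeakDeriv e u v) :
    IsWeakDeriv e (z • u) (z • v) := by
  have key : ∀ (p : L2 P) (c : ℝ × ℝ → ℝ),
      ∫ x, (z • p) x * (c x : ℝ) ∂P.μ = z * ∫ x, p x * (c x : ℝ) ∂P.μ := by
    intro p c
    rw [← integral_const_mul]
    refine integral_congr_ae ?_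
    filter_upwards [Lp.coeFn_smul z p] with x hx
    rw [hx, Pi.smul_apply, smul_eq_mul, mul_assoc]
  intro φ hφ
  rw [key, key, h φ hφ, mul_neg]

lemma isWeakDeriv_zero (e : ℝ × ℝ) : IsWeakDeriv e (0 : L2 P) 0 := by
  have hz : ∀ c : ℝ × ℝ → ℝ, ∫ x, (0 : L2 P) x * (c x : ℝ) ∂P.μ = 0 := by
    intro c
    refine integral_eq_zero_of_ae ?_
    filter_upwards [Lp.coeFn_zero ℂ 2 P.μ] with x hx
    rw [hx]
    exact zero_mul _
  intro φ _
  rw [hz, hz, neg_zero]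

lemma isWeakDeriv_wderiv {e : ℝ × ℝ} {u : L2 P} (h : ∃ v, IsWeakDeriv e u v) :
    IsWeakDeriv e u (wderiv e u) := by
  rw [wderiv, dif_pos h]
  exact h.choose_spec

lemma IsWeakDeriv.wderiv_eq {e : ℝ × ℝ} {u v : L2 P} (h : IsWeakDeriv e u v) :
    wderiv e u = v :=
  (isWeakDeriv_wderiv ⟨v, h⟩).unique h

lemma wderiv_add {e : ℝ × ℝ} {u v : L2 P} (hu : ∃ w, IsWeakDeriv e u w)
    (hv : ∃ w, IsWeakDeriv e v w) : wderiv e (u + v) = wderiv e u + wderiv e v :=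
  ((isWeakDeriv_wderiv hu).add (isWeakDeriv_wderiv hv)).wderiv_eq

lemma wderiv_smul {e : ℝ × ℝ} {u : L2 P} (z : ℂ) (hu : ∃ w, IsWeakDeriv e u w) :
    wderiv e (z • u) = z • wderiv e u :=
  ((isWeakDeriv_wderiv hu).smul z).wderiv_eq

lemma MemH1.add {u v : L2 P} (hu : MemH1 u) (hv : MemH1 v) : MemH1 (u + v) :=
  ⟨⟨_, (isWeakDeriv_wderiv hu.1).add (isWeakDeriv_wderiv hv.1)⟩,
    ⟨_, (isWeakDeriv_wderiv hu.2).add (isWeakDeriv_wderiv hv.2)⟩⟩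

lemma MemH1.smul {u : L2 P} (z : ℂ) (hu : MemH1 u) : MemH1 (z • u) :=
  ⟨⟨_, (isWeakDeriv_wderiv hu.1).smul z⟩, ⟨_, (isWeakDeriv_wderiv hu.2).smul z⟩⟩

lemma memH1_zero : MemH1 (0 : L2 P) := ⟨⟨_, isWeakDeriv_zero er⟩, ⟨_, isWeakDeriv_zero eψ⟩⟩

/-! ### The solution space `X` -/

/-- The boundary conditions, stated for the representative of `u` that is continuous on the closed
rectangle: `u(rmin, ψ) = u(rmax, ψ) = 0` and `u(r, 0) = u(r, 2π)`. -/
def BoundaryCond (u : L2 P) : Prop :=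
  ∃ U : ℝ × ℝ → ℂ, ContinuousOn U P.Ωbar ∧ u =ᵐ[P.μ] U ∧
    (∀ ψ ∈ Ioo 0 (2 * Real.pi), U (P.rmin, ψ) = 0 ∧ U (P.rmax, ψ) = 0) ∧
    ∀ r ∈ Ioo P.rmin P.rmax, U (r, 0) = U (r, 2 * Real.pi)

variable (P)

/-- The functions of class `H²` on the cylinder that satisfy the boundary conditions. -/
def XSubmodule : Submodule ℂ (L2 P) where
  carrier := {u | MemH2 u ∧ BoundaryCond u}
  add_mem' := by
    rintro u v ⟨⟨u1, u2, u3⟩, U, hU, hUe, hUb, hUp⟩ ⟨⟨v1, v2, v3⟩, V, hV, hVe, hVb, hVp⟩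
    refine ⟨⟨u1.add v1, ?_, ?_⟩, U + V, hU.add hV, ?_, ?_, ?_⟩
    · rw [wderiv_add u1.1 v1.1]
      exact u2.add v2
    · rw [wderiv_add u1.2 v1.2]
      exact u3.add v3
    · exact (Lp.coeFn_add u v).trans (hUe.add hVe)
    · intro ψ hψ
      simp [hUb ψ hψ, hVb ψ hψ]
    · intro r hr
      simp [hUp r hr, hVp r hr]
  zero_mem' := by
    refine ⟨⟨memH1_zero, ?_, ?_⟩, 0, continuousOn_const, Lp.coeFn_zero ℂ 2 P.μ, ?_, ?_⟩
    · rw [(isWeakDeriv_zero er).wderiv_eq]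
      exact memH1_zero
    · rw [(isWeakDeriv_zero eψ).wderiv_eq]
      exact memH1_zero
    · simp
    · simp
  smul_mem' := by
    rintro z u ⟨⟨u1, u2, u3⟩, U, hU, hUe, hUb, hUp⟩
    refine ⟨⟨u1.smul z, ?_, ?_⟩, z • U, hU.const_smul z, ?_, ?_, ?_⟩
    · rw [wderiv_smul z u1.1]
      exact u2.smul z
    · rw [wderiv_smul z u1.2]
      exact u3.smul z
    · exact (Lp.coeFn_smul z u).trans (hUe.const_smul z)
    · intro ψ hψ
      simp [hUb ψ hψ]
    · intro r hr
      simp [hUp r hr]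

/-- The space `X`, a copy of `XSubmodule` that does not carry the `L²` norm; its own norm is
defined below. -/
def X : Type := XSubmodule P

noncomputable instance : AddCommGroup (X P) := inferInstanceAs (AddCommGroup (XSubmodule P))

noncomputable instance : Module ℂ (X P) := inferInstanceAs (Module ℂ (XSubmodule P))

/-- The inclusion of `X` into `L²`. -/
noncomputable def X.toL2 : X P →ₗ[ℂ] L2 P := (XSubmodule P).subtype

variable {P}

lemma X.memH2 (u : X P) : MemH2 (X.toL2 P u) := u.2.1

lemma X.toL2_injective : Function.Injective (X.toL2 P) := Subtype.val_injective

/-- The weak derivative `∂_r u` of `u ∈ X`. -/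
noncomputable def X.dr : X P →ₗ[ℂ] L2 P where
  toFun u := wderiv er (X.toL2 P u)
  map_add' u v := by rw [map_add, wderiv_add u.memH2.1.1 v.memH2.1.1]
  map_smul' z u := by rw [map_smul, wderiv_smul z u.memH2.1.1, RingHom.id_apply]

/-- The weak derivative `∂_ψ u` of `u ∈ X`. -/
noncomputable def X.dψ : X P →ₗ[ℂ] L2 P where
  toFun u := wderiv eψ (X.toL2 P u)
  map_add' u v := by rw [map_add, wderiv_add u.memH2.1.2 v.memH2.1.2]
  map_smul' z u := by rw [map_smul, wderiv_smul z u.memH2.1.2, RingHom.id_apply]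

/-- The weak derivative `∂_r² u` of `u ∈ X`. -/
noncomputable def X.drr : X P →ₗ[ℂ] L2 P where
  toFun u := wderiv er (X.dr u)
  map_add' u v := by
    rw [map_add]
    exact wderiv_add u.memH2.2.1.1 v.memH2.2.1.1
  map_smul' z u := by
    rw [map_smul]
    exact wderiv_smul z u.memH2.2.1.1

/-- The weak derivative `∂_ψ² u` of `u ∈ X`. -/
noncomputable def X.dψψ : X P →ₗ[ℂ] L2 P where
  toFun u := wderiv eψ (X.dψ u)
  map_add' u v := by
    rw [map_add]
    exact wderiv_add u.memH2.2.2.2 v.memH2.2.2.2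
  map_smul' z u := by
    rw [map_smul]
    exact wderiv_smul z u.memH2.2.2.2

/-- The second component `(2 / r) ∂_ψ u` of the modified gradient; the first one is `∂_r u`. -/
noncomputable def X.gradψ : X P →ₗ[ℂ] L2 P := mulL2 cGrad P.continuousOn_cGrad ∘ₗ X.dψ

/-- The modified Laplacian `∂_r² u + (4 / r²) ∂_ψ² u`. -/
noncomputable def X.lap : X P →ₗ[ℂ] L2 P :=
  X.drr + mulL2 cLap P.continuousOn_cLap ∘ₗ X.dψψ

/-- The inner product of `X`: the sum of the `L²` inner products of the functions, of their modified
gradients and, with weight `ξ₂`, of their modified Laplacians. (Mathlib's inner products are linear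
in the second argument.) -/
@[reducible]
noncomputable def X.core : InnerProductSpace.Core ℂ (X P) where
  inner u v := inner ℂ (X.toL2 P u) (X.toL2 P v)
    + (inner ℂ (X.dr u) (X.dr v) + inner ℂ (X.gradψ u) (X.gradψ v))
    + (P.ξ₂ : ℂ) * inner ℂ (X.lap u) (X.lap v)
  conj_inner_symm u v := by
    simp only [map_add, map_mul, inner_conj_symm, Complex.conj_ofReal]
  re_inner_nonneg u := by
    have h : ∀ w : L2 P, inner ℂ w w = ((‖w‖ ^ 2 : ℝ) : ℂ) := fun w => by
      rw [inner_self_eq_norm_sq_to_K]; norm_cast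
    have hξ := P.ξ₂_pos
    simp only [h, ← Complex.ofReal_mul, ← Complex.ofReal_add, RCLike.re_to_complex,
      Complex.ofReal_re]
    positivity
  add_left u v w := by
    simp only [map_add, inner_add_left]
    ring
  smul_left u v z := by
    simp only [map_smul, inner_smul_left]
    ring
  definite u hu := by
    have h : ∀ w : L2 P, inner ℂ w w = ((‖w‖ ^ 2 : ℝ) : ℂ) := fun w => by
      rw [inner_self_eq_norm_sq_to_K]; norm_cast
    have hξ := P.ξ₂_pos
    change inner ℂ (X.toL2 P u) (X.toL2 P u)
      + (inner ℂ (X.dr u) (X.dr u) + inner ℂ (X.gradψ u) (X.gradψ u))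
      + (P.ξ₂ : ℂ) * inner ℂ (X.lap u) (X.lap u) = 0 at hu
    simp only [h] at hu
    norm_cast at hu
    have h0 : ‖X.toL2 P u‖ ^ 2 = 0 := by
      have h2 : 0 ≤ P.ξ₂ * ‖X.lap u‖ ^ 2 := by positivity
      nlinarith [sq_nonneg ‖X.toL2 P u‖, sq_nonneg ‖X.dr u‖, sq_nonneg ‖X.gradψ u‖]
    have h1 : X.toL2 P u = 0 := norm_eq_zero.1 (pow_eq_zero_iff two_ne_zero |>.1 h0)
    exact X.toL2_injective (h1.trans (map_zero _).symm)

noncomputable instance : NormedAddCommGroup (X P) := X.core.toNormedAddCommGroup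

noncomputable instance : InnerProductSpace ℂ (X P) := InnerProductSpace.ofCore X.core.toCore

/-! ### The zero-finding problem -/

variable (P)

/-- The space `𝒳 = X × ℂ`, with the norm `(‖u‖² + |λ|²)^(1/2)`. -/
abbrev XC := WithLp 2 (X P × ℂ)

/-- The space `𝒴 = L² × ℂ`, with the norm `(‖u‖² + |λ|²)^(1/2)`. -/
abbrev YC := WithLp 2 (L2 P × ℂ)

variable {P}

/-- The backward Kolmogorov operator
`L u = (σ² / 2) (∂_r² u + (4 / r²) ∂_ψ² u) + f ∂_r u + g ∂_ψ u`. -/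
noncomputable def opL : X P →ₗ[ℂ] L2 P :=
  ((P.σ ^ 2 / 2 : ℝ) : ℂ) • X.lap + mulL2 P.f P.continuousOn_f ∘ₗ X.dr
    + mulL2 P.g P.continuousOn_g ∘ₗ X.dψ

/-- The map `(u, λ) ↦ (L u - λ u, ⟨u, ubar⟩ - 1)`, with the inner product of `L²` linear in `u`. -/
noncomputable def F (ubar : X P) (p : XC P) : YC P :=
  WithLp.toLp 2 (opL p.fst - p.snd • X.toL2 P p.fst,
    inner ℂ (X.toL2 P ubar) (X.toL2 P p.fst) - 1)

/-- The function does not depend on the angle `ψ`. -/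
def IsRadial (u : L2 P) : Prop := ∃ v : ℝ → ℂ, ∀ᵐ x ∂P.μ, u x = v x.1

end ShearHopf

/-! Write `p̄ = (ū, λ̄)`, `A = F'(p̄)` and `B = F''`. The only nonlinear term of `F` is `-λu`, so
`F` is a polynomial of degree two and `F (p̄ + h) = F p̄ + A h + ½ B h h` holds exactly (`F_add`).

Uniqueness uses only `‖p‖ ≤ κ‖A p‖`: subtracting the equations of two zeros in the ball bounds their
distance by `κγρ < 1` times itself (`eq_of_quadratic_zero`).

Existence also requires solving `A p = z`, and the bound on `A` gives injectivity only. Radial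
symmetry of `ū` closes this gap. The one coefficient of `L` that depends on `ψ` is `g`, and it
multiplies `∂_ψ u`, which vanishes for radial `u`; hence `F p̄` is radial, and so is `B p p` for
radial `p`. For radial `z`, the equation `A p = z` becomes a linear second-order ODE with two
boundary conditions, one additional scalar unknown (the increment of `λ`) and one additional scalar
condition. Initial value problems are always solvable, so a 2×2 linear system for the initial slope
and the increment of `λ` remains. Injectivity of `A` makes its matrix injective, hence invertible
(`exists_fderiv_F_eq`).

A Newton–Kantorovich argument on radial pairs (`exists_quadratic_zero`) then yields a radial zero.
Uniqueness in the full ball shows that there is no other zero, so the zero is radial.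

In the weak setting, `∂_ψ u = 0` for radial `u` because test functions are periodic, and `∂_r u` is
radial because a test function may be replaced by its average over the angle. -/

namespace ShearHopf

/-! ### Zeros of quadratic maps -/

section Quadratic

variable {E Y : Type*} [NormedAddCommGroup E] [NormedSpace ℂ E] [NormedAddCommGroup Y]
  [NormedSpace ℂ Y]

/-- The increment of the quadratic part of a quadratic map with symmetric second derivative. -/
lemma map_self_sub_map_self (B : E →L[ℂ] E →L[ℂ] Y) (hsymm : ∀ p q, B p q = B q p) (p q : E) :
    B p p - B q q = B (p + q) (p - q) := by
  simp only [map_add, map_sub, add_apply]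
  rw [hsymm q p]
  abel

lemma fderiv_quadratic (A : E →L[ℂ] Y) (B : E →L[ℂ] E →L[ℂ] Y) (hsymm : ∀ p q, B p q = B q p)
    (y : Y) : fderiv ℂ (fun p => A p + (1 / 2 : ℂ) • B p p + y) = fun p => A + B p := by
  funext p
  refine HasFDerivAt.fderiv ?_
  have h1 : HasFDerivAt (fun q => B q q) (B p + B.flip p) p := by
    refine (B.hasFDerivAt_of_bilinear (hasFDerivAt_id p) (hasFDerivAt_id p)).congr_fderiv ?_
    ext q
    simp
  have h2 : A + B p = A + (1 / 2 : ℂ) • (B p + B.flip p) := by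
    have : B.flip p = B p := ContinuousLinearMap.ext fun q => hsymm q p
    rw [this, ← two_smul ℂ, smul_smul]
    norm_num
  rw [h2]
  exact (A.hasFDerivAt.add (h1.const_smul _)).add_const _

lemma fderiv_affine (y : Y) (A : E →L[ℂ] Y) (p : E) : fderiv ℂ (fun p => y + A p) p = A :=
  (A.hasFDerivAt.const_add y).fderiv

lemma quadratic_add (A : E →L[ℂ] Y) (B : E →L[ℂ] E →L[ℂ] Y) (hsymm : ∀ p q, B p q = B q p)
    (y : Y) (p h : E) : A (p + h) + (1 / 2 : ℂ) • B (p + h) (p + h) + y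
      = A p + (1 / 2 : ℂ) • B p p + y + (A + B p) h + (1 / 2 : ℂ) • B h h := by
  simp only [map_add, add_apply, hsymm h p, smul_add]
  have : B p h = (1 / 2 : ℂ) • B p h + (1 / 2 : ℂ) • B p h := by
    rw [← add_smul]; norm_num
  nth_rewrite 3 [this]
  abel

/-- Two zeros of a quadratic map in a ball of radius less than `1 / (κ γ)` coincide. -/
lemma eq_of_quadratic_zero (A : E →L[ℂ] Y) (B : E →L[ℂ] E →L[ℂ] Y)
    (hsymm : ∀ p q, B p q = B q p) {y₀ : Y} {κ γ ρ : ℝ} (hκ0 : 0 ≤ κ) (hγ0 : 0 ≤ γ)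
    (hκ : ∀ p, ‖p‖ ≤ κ * ‖A p‖) (hγ : ∀ p q, ‖B p q‖ ≤ γ * ‖p‖ * ‖q‖) (hρ : κ * γ * ρ < 1)
    {p q : E} (hp : y₀ + A p + (1 / 2 : ℂ) • B p p = 0)
    (hq : y₀ + A q + (1 / 2 : ℂ) • B q q = 0) (hpρ : ‖p‖ ≤ ρ) (hqρ : ‖q‖ ≤ ρ) : p = q := by
  have h1 : A (p - q) = -((1 / 2 : ℂ) • B (p + q) (p - q)) := by
    rw [← map_self_sub_map_self B hsymm, smul_sub, map_sub]
    have := hp.trans hq.symm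
    rw [add_assoc, add_assoc] at this
    have h2 := add_left_cancel this
    have h3 : A p = A q + (1 / 2 : ℂ) • B q q - (1 / 2 : ℂ) • B p p := eq_sub_of_add_eq h2
    rw [h3]
    abel
  have h2 : ‖A (p - q)‖ ≤ γ * ρ * ‖p - q‖ := by
    rw [h1, norm_neg, norm_smul]
    have h3 : ‖(1 / 2 : ℂ)‖ = 1 / 2 := by norm_num
    have h4 := hγ (p + q) (p - q)
    have h5 : ‖p + q‖ ≤ ρ + ρ := (norm_add_le p q).trans (add_le_add hpρ hqρ)
    have h6 : γ * ‖p + q‖ * ‖p - q‖ ≤ γ * (ρ + ρ) * ‖p - q‖ := by gcongr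
    rw [h3]
    linarith
  have h3 : ‖p - q‖ ≤ κ * γ * ρ * ‖p - q‖ := by
    calc ‖p - q‖ ≤ κ * ‖A (p - q)‖ := hκ _
      _ ≤ κ * (γ * ρ * ‖p - q‖) := by gcongr
      _ = κ * γ * ρ * ‖p - q‖ := by ring
  have h4 : ‖p - q‖ = 0 := by nlinarith [norm_nonneg (p - q)]
  exact sub_eq_zero.1 (norm_eq_zero.1 h4)

/-- A Newton–Kantorovich theorem for quadratic maps whose derivative maps a subspace `S` onto a
closed subspace `Z`. -/
lemma exists_quadratic_zero [CompleteSpace Y] (A : E →L[ℂ] Y) (B : E →L[ℂ] E →L[ℂ] Y)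
    (hsymm : ∀ p q, B p q = B q p) (S : Submodule ℂ E) (Z : Submodule ℂ Y)
    (hZ : IsClosed (Z : Set Y)) {y₀ : Y} (hy₀ : y₀ ∈ Z) (hBZ : ∀ p ∈ S, B p p ∈ Z)
    (hsurj : ∀ z ∈ Z, ∃ p ∈ S, A p = z) {κ γ δ : ℝ} (hκ0 : 0 < κ) (hγ0 : 0 < γ)
    (hκ : ∀ p, ‖p‖ ≤ κ * ‖A p‖) (hγ : ∀ p q, ‖B p q‖ ≤ γ * ‖p‖ * ‖q‖) (hδ : ‖y₀‖ ≤ δ)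
    (hcond : 2 * κ ^ 2 * γ * δ < 1) :
    ∃ p ∈ S, y₀ + A p + (1 / 2 : ℂ) • B p p = 0 ∧
      ‖p‖ ≤ (1 - √(1 - 2 * κ ^ 2 * γ * δ)) / (κ * γ) := by
  set s := √(1 - 2 * κ ^ 2 * γ * δ) with hs
  have hs2 : s ^ 2 = 1 - 2 * κ ^ 2 * γ * δ := Real.sq_sqrt (by linarith)
  have hs0 : 0 < s := Real.sqrt_pos.2 (by linarith)
  have hδ0 : 0 ≤ δ := (norm_nonneg _).trans hδ
  have hs1 : s ≤ 1 := by
    have : 0 ≤ 2 * κ ^ 2 * γ * δ := by positivity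
    nlinarith
  -- This is the smaller root of `κ (δ + ½ γ r²) = r`, the equation that makes the ball of radius
  -- `r` invariant under the iteration below.
  set r := (1 - s) / (κ * γ) with hr
  have hr0 : 0 ≤ r := div_nonneg (by linarith) (by positivity)
  have hrs : κ * γ * r = 1 - s := by rw [hr]; field_simp
  have hquad : κ * (δ + 1 / 2 * γ * r ^ 2) = r := by
    have hne : 2 * κ * γ ≠ 0 := by positivity
    refine mul_left_cancel₀ hne ?_
    have : (κ * γ * r) ^ 2 = (1 - s) ^ 2 := by rw [hrs]
    nlinarith
  have h2 : ‖(1 / 2 : ℂ)‖ = 1 / 2 := by norm_num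
  -- A right inverse of `A` on `Z` with values in `S`. Linearity of `g` is not needed: the lower
  -- bound on `A` makes it `κ`-Lipschitz.
  choose g hgS hgA using hsurj
  have hgn : ∀ z (hz : z ∈ Z), ‖g z hz‖ ≤ κ * ‖z‖ := fun z hz => by
    simpa only [hgA] using hκ (g z hz)
  have hgl : ∀ z (hz : z ∈ Z) w (hw : w ∈ Z), ‖g z hz - g w hw‖ ≤ κ * ‖z - w‖ :=
    fun z hz w hw => by simpa only [map_sub, hgA] using hκ (g z hz - g w hw)
  -- The iteration runs in the variable `z = A p`, so that completeness is required of `Y` and not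
  -- of `E`.
  let K : Set Y := {z | z ∈ Z ∧ κ * ‖z‖ ≤ r}
  have hK : IsClosed K := hZ.inter (isClosed_le (continuous_const.mul continuous_norm) continuous_const)
  have hmaps : ∀ z (hz : z ∈ K), -(y₀ + (1 / 2 : ℂ) • B (g z hz.1) (g z hz.1)) ∈ K := by
    intro z hz
    refine ⟨Z.neg_mem (Z.add_mem hy₀ (Z.smul_mem _ (hBZ _ (hgS _ _)))), ?_⟩
    rw [norm_neg]
    have hb := hγ (g z hz.1) (g z hz.1)
    have hn : ‖g z hz.1‖ ≤ r := (hgn z hz.1).trans hz.2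
    have h4 : γ * ‖g z hz.1‖ * ‖g z hz.1‖ ≤ γ * r * r := by gcongr
    calc κ * ‖y₀ + (1 / 2 : ℂ) • B (g z hz.1) (g z hz.1)‖
        ≤ κ * (δ + 1 / 2 * γ * r ^ 2) := by
          gcongr
          refine (norm_add_le _ _).trans (add_le_add hδ ?_)
          rw [norm_smul, h2]
          nlinarith
      _ = r := hquad
  let T : K → K := fun z => ⟨_, hmaps z z.2⟩
  -- The Lipschitz constant is `½ γ (r + r) κ = κ γ r = 1 - s`, which is below one because `s > 0`.
  have hlip : ContractingWith (1 - s).toNNReal T := by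
    constructor
    · rw [Real.toNNReal_lt_one]
      linarith
    · refine LipschitzWith.of_dist_le_mul fun z w => ?_
      rw [Real.coe_toNNReal _ (by linarith), Subtype.dist_eq, Subtype.dist_eq, dist_eq_norm,
        dist_eq_norm]
      change ‖-(y₀ + (1 / 2 : ℂ) • B (g z z.2.1) (g z z.2.1))
        - -(y₀ + (1 / 2 : ℂ) • B (g w w.2.1) (g w w.2.1))‖ ≤ _
      have e : -(y₀ + (1 / 2 : ℂ) • B (g z z.2.1) (g z z.2.1))
          - -(y₀ + (1 / 2 : ℂ) • B (g w w.2.1) (g w w.2.1))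
          = -((1 / 2 : ℂ) • B (g z z.2.1 + g w w.2.1) (g z z.2.1 - g w w.2.1)) := by
        rw [← map_self_sub_map_self B hsymm, smul_sub]
        abel
      rw [e, norm_neg, norm_smul, h2]
      have h3 := hγ (g z z.2.1 + g w w.2.1) (g z z.2.1 - g w w.2.1)
      have h4 : ‖g z z.2.1 + g w w.2.1‖ ≤ r + r :=
        (norm_add_le _ _).trans (add_le_add ((hgn _ _).trans z.2.2) ((hgn _ _).trans w.2.2))
      have h5 := hgl z z.2.1 w w.2.1
      have h6 : γ * ‖g z z.2.1 + g w w.2.1‖ * ‖g z z.2.1 - g w w.2.1‖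
          ≤ γ * (r + r) * (κ * ‖(z : Y) - w‖) := by gcongr
      rw [← hrs]
      linarith
  have : CompleteSpace K := hK.completeSpace_coe
  have : Nonempty K := ⟨⟨0, Z.zero_mem, by simpa using hr0⟩⟩
  set z := hlip.fixedPoint T with hz
  have hfix : T z = z := hlip.fixedPoint_isFixedPt
  refine ⟨g z z.2.1, hgS _ _, ?_, (hgn _ _).trans z.2.2⟩
  have e : A (g z z.2.1) = -(y₀ + (1 / 2 : ℂ) • B (g z z.2.1) (g z z.2.1)) :=
    (hgA _ _).trans (congrArg Subtype.val hfix).symm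
  rw [e]
  abel

end Quadratic

/-! ### Boundedness of the operators and derivatives of `F` -/

variable {P : Params}

lemma coeFn_mulL2 {c : ℝ × ℝ → ℝ} (hc : ContinuousOn c P.Ωbar) (u : L2 P) :
    mulL2 c hc u =ᵐ[P.μ] fun x => (c x : ℂ) * u x :=
  (memLp_mul hc u).coeFn_toLp

lemma exists_norm_mulL2_le {c : ℝ × ℝ → ℝ} (hc : ContinuousOn c P.Ωbar) :
    ∃ C : ℝ, 0 ≤ C ∧ ∀ u : L2 P, ‖mulL2 c hc u‖ ≤ C * ‖u‖ := by
  obtain ⟨C, hC⟩ := P.isCompact_Ωbar.exists_bound_of_continuousOn hc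
  refine ⟨max C 0, le_max_right _ _, fun u => Lp.norm_le_mul_norm_of_ae_le_mul ?_⟩
  filter_upwards [coeFn_mulL2 hc u, P.ae_mem] with x hx hm
  rw [hx, norm_mul, Complex.norm_real]
  gcongr
  exact (hC x (P.Ω_subset hm)).trans (le_max_left _ _)

lemma norm_sq_eq (u : X P) : ‖u‖ ^ 2 = ‖X.toL2 P u‖ ^ 2 + (‖X.dr u‖ ^ 2 + ‖X.gradψ u‖ ^ 2)
    + P.ξ₂ * ‖X.lap u‖ ^ 2 := by
  have h : ∀ w : L2 P, inner ℂ w w = ((‖w‖ ^ 2 : ℝ) : ℂ) := fun w => by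
    rw [inner_self_eq_norm_sq_to_K]; norm_cast
  have h1 : inner ℂ u u = ((‖u‖ ^ 2 : ℝ) : ℂ) := by
    rw [inner_self_eq_norm_sq_to_K]; norm_cast
  have h2 : inner ℂ u u = inner ℂ (X.toL2 P u) (X.toL2 P u)
      + (inner ℂ (X.dr u) (X.dr u) + inner ℂ (X.gradψ u) (X.gradψ u))
      + (P.ξ₂ : ℂ) * inner ℂ (X.lap u) (X.lap u) := rfl
  rw [h1] at h2
  simp only [h] at h2
  exact_mod_cast h2

lemma norm_toL2_le (u : X P) : ‖X.toL2 P u‖ ≤ ‖u‖ := by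
  refine (pow_le_pow_iff_left₀ (by positivity) (norm_nonneg _) two_ne_zero).1 ?_
  have hξ := P.ξ₂_pos
  have h := norm_sq_eq u
  have : 0 ≤ P.ξ₂ * ‖X.lap u‖ ^ 2 := by positivity
  nlinarith [sq_nonneg ‖X.dr u‖, sq_nonneg ‖X.gradψ u‖]

lemma norm_dr_le (u : X P) : ‖X.dr u‖ ≤ ‖u‖ := by
  refine (pow_le_pow_iff_left₀ (by positivity) (norm_nonneg _) two_ne_zero).1 ?_
  have hξ := P.ξ₂_pos
  have h := norm_sq_eq u
  have : 0 ≤ P.ξ₂ * ‖X.lap u‖ ^ 2 := by positivity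
  nlinarith [sq_nonneg ‖X.toL2 P u‖, sq_nonneg ‖X.gradψ u‖]

lemma norm_gradψ_le (u : X P) : ‖X.gradψ u‖ ≤ ‖u‖ := by
  refine (pow_le_pow_iff_left₀ (by positivity) (norm_nonneg _) two_ne_zero).1 ?_
  have hξ := P.ξ₂_pos
  have h := norm_sq_eq u
  have : 0 ≤ P.ξ₂ * ‖X.lap u‖ ^ 2 := by positivity
  nlinarith [sq_nonneg ‖X.toL2 P u‖, sq_nonneg ‖X.dr u‖]

lemma norm_lap_le (u : X P) : ‖X.lap u‖ ≤ (√P.ξ₂)⁻¹ * ‖u‖ := by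
  have hξ := P.ξ₂_pos
  have hs := Real.sqrt_pos.2 hξ
  rw [inv_mul_eq_div, le_div_iff₀ hs]
  refine (pow_le_pow_iff_left₀ (by positivity) (norm_nonneg _) two_ne_zero).1 ?_
  have h := norm_sq_eq u
  rw [mul_pow, Real.sq_sqrt hξ.le]
  nlinarith [sq_nonneg ‖X.toL2 P u‖, sq_nonneg ‖X.dr u‖, sq_nonneg ‖X.gradψ u‖]

/-- The norm of `X` sees `∂_ψ u` only through `(2/r) ∂_ψ u`. Undoing the weight bounds `∂_ψ u`, and
with it the term `g ∂_ψ u` of `L`. -/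
lemma dψ_eq (u : X P) : X.dψ u = mulL2 (fun x => x.1 / 2) (by fun_prop) (X.gradψ u) := by
  refine Lp.ext ?_
  have h1 := coeFn_mulL2 P.continuousOn_cGrad (X.dψ u)
  have h2 := coeFn_mulL2 (P := P) (c := fun x => x.1 / 2) (by fun_prop) (X.gradψ u)
  filter_upwards [h1, h2, P.ae_mem] with x h1 h2 hx
  have hx0 : (x.1 : ℂ) ≠ 0 := by exact_mod_cast P.ne_zero_of_mem (P.Ω_subset hx)
  rw [h2, X.gradψ, LinearMap.comp_apply, h1]
  simp only [cGrad]
  push_cast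
  field_simp

/-- No elliptic estimate is involved: the second-order part of `L` is a multiple of the modified
Laplacian, which the norm of `X` controls directly since `ξ₂ > 0`. -/
lemma exists_norm_opL_le : ∃ C : ℝ, ∀ u : X P, ‖opL u‖ ≤ C * ‖u‖ := by
  obtain ⟨C₁, h₁, H₁⟩ := exists_norm_mulL2_le P.continuousOn_f
  obtain ⟨C₂, h₂, H₂⟩ := exists_norm_mulL2_le P.continuousOn_g
  obtain ⟨C₃, h₃, H₃⟩ := exists_norm_mulL2_le (P := P) (c := fun x => x.1 / 2) (by fun_prop)
  refine ⟨‖((P.σ ^ 2 / 2 : ℝ) : ℂ)‖ * (√P.ξ₂)⁻¹ + C₁ + C₂ * C₃, fun u => ?_⟩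
  have e : opL u = ((P.σ ^ 2 / 2 : ℝ) : ℂ) • X.lap u + mulL2 P.f P.continuousOn_f (X.dr u)
    + mulL2 P.g P.continuousOn_g (X.dψ u) := rfl
  rw [e, add_mul, add_mul]
  refine (norm_add₃_le).trans (add_le_add (add_le_add ?_ ?_) ?_)
  · rw [norm_smul, mul_assoc]
    gcongr
    exact norm_lap_le u
  · exact (H₁ _).trans (by gcongr; exact norm_dr_le u)
  · rw [mul_assoc, dψ_eq]
    refine (H₂ _).trans ?_
    gcongr
    exact (H₃ _).trans (by gcongr; exact norm_gradψ_le u)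

/-- The operator `L` as a bounded operator. -/
noncomputable def opLCLM : X P →L[ℂ] L2 P :=
  opL.mkContinuousOfExistsBound exists_norm_opL_le

/-- The inclusion of `X` into `L²` as a bounded operator. -/
noncomputable def toL2CLM : X P →L[ℂ] L2 P :=
  (X.toL2 P).mkContinuous 1 fun u => by rw [one_mul]; exact norm_toL2_le u

/-- The linear part `(u, λ) ↦ (L u, ⟨u, ubar⟩)` of `F`. -/
noncomputable def linPart (ubar : X P) : XC P →L[ℂ] YC P :=
  (WithLp.prodContinuousLinearEquiv 2 ℂ (L2 P) ℂ).symm.toContinuousLinearMap ∘L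
    ((opLCLM ∘L WithLp.fstL 2 ℂ (X P) ℂ).prod
      (innerSL ℂ (X.toL2 P ubar) ∘L toL2CLM ∘L WithLp.fstL 2 ℂ (X P) ℂ))

/-- The second derivative of `F`. -/
noncomputable def bilPart : XC P →L[ℂ] XC P →L[ℂ] YC P :=
  ((ContinuousLinearMap.compL ℂ (XC P) (L2 P) (YC P)
      ((WithLp.prodContinuousLinearEquiv 2 ℂ (L2 P) ℂ).symm.toContinuousLinearMap ∘L
        ContinuousLinearMap.inl ℂ (L2 P) ℂ)) ∘L
    (-(((ContinuousLinearMap.lsmul ℂ ℂ).bilinearComp (WithLp.sndL 2 ℂ (X P) ℂ)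
        (toL2CLM ∘L WithLp.fstL 2 ℂ (X P) ℂ))
      + ((ContinuousLinearMap.lsmul ℂ ℂ).bilinearComp (WithLp.sndL 2 ℂ (X P) ℂ)
        (toL2CLM ∘L WithLp.fstL 2 ℂ (X P) ℂ)).flip)))

lemma linPart_apply (ubar : X P) (p : XC P) : linPart ubar p
    = WithLp.toLp 2 (opL p.fst, inner ℂ (X.toL2 P ubar) (X.toL2 P p.fst)) := rfl

lemma bilPart_apply (p q : XC P) : bilPart p q
    = WithLp.toLp 2 (-(p.snd • X.toL2 P q.fst + q.snd • X.toL2 P p.fst), 0) := rfl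

lemma bilPart_symm (p q : XC P) : bilPart p q = bilPart q p := by
  rw [bilPart_apply, bilPart_apply, add_comm]

lemma F_eq (ubar : X P) : F ubar = fun p => linPart ubar p + (1 / 2 : ℂ) • bilPart p p
    + WithLp.toLp 2 (0, -1) := by
  funext p
  rw [linPart_apply, bilPart_apply, F, ← WithLp.toLp_smul, ← WithLp.toLp_add, ← WithLp.toLp_add]
  congr 1
  refine Prod.ext ?_ ?_
  · simp only [Prod.fst_add, Prod.smul_fst, add_zero, ← two_smul ℂ, smul_neg, smul_smul]
    rw [← mul_assoc]
    norm_num [sub_eq_add_neg]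
  · simp [sub_eq_add_neg]

lemma fderiv_F (ubar : X P) : fderiv ℂ (F ubar) = fun p => linPart ubar + bilPart p := by
  rw [F_eq]
  exact fderiv_quadratic _ _ bilPart_symm _

lemma fderiv_fderiv_F (ubar : X P) (p : XC P) : fderiv ℂ (fderiv ℂ (F ubar)) p = bilPart := by
  rw [fderiv_F]
  exact fderiv_affine (E := XC P) (Y := XC P →L[ℂ] YC P) _ _ _

/-- The Taylor expansion of `F`. -/
lemma F_add (ubar : X P) (p h : XC P) :
    F ubar (p + h) = F ubar p + fderiv ℂ (F ubar) p h + (1 / 2 : ℂ) • bilPart h h := by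
  rw [fderiv_F, F_eq]
  exact quadratic_add (E := XC P) (Y := YC P) _ _ bilPart_symm _ _ _

/-! ### Functions of the radius -/

lemma Params.μ_eq : P.μ = ENNReal.ofReal (1 / (2 * Real.pi * (P.rmax - P.rmin))) •
    ((volume.restrict (Ioo P.rmin P.rmax)).prod (volume.restrict (Ioo 0 (2 * Real.pi)))) := by
  rw [Params.μ, Params.Ω, Measure.prod_restrict, Measure.volume_eq_prod]

variable (P) in
/-- The image of the normalised measure on `Ω` under the projection to the radius. -/
noncomputable def Params.ν : Measure ℝ := P.μ.map Prod.fst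

lemma measurePreserving_radius : MeasurePreserving Prod.fst P.μ P.ν := ⟨measurable_fst, rfl⟩

lemma Params.ν_eq : P.ν = (ENNReal.ofReal (1 / (2 * Real.pi * (P.rmax - P.rmin))) *
    ENNReal.ofReal (2 * Real.pi)) • volume.restrict (Ioo P.rmin P.rmax) := by
  rw [Params.ν, Params.μ_eq, Measure.map_smul, Measure.map_fst_prod, smul_smul]
  simp

lemma Params.ν_ac : P.ν ≪ volume.restrict (Ioo P.rmin P.rmax) := by
  rw [Params.ν_eq]
  exact Measure.smul_absolutelyContinuous

lemma Params.ν_scale_ne_zero : ENNReal.ofReal (1 / (2 * Real.pi * (P.rmax - P.rmin))) *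
    ENNReal.ofReal (2 * Real.pi) ≠ 0 :=
  mul_ne_zero (ENNReal.ofReal_pos.2 P.scale_pos).ne' (ENNReal.ofReal_pos.2 Real.two_pi_pos).ne'

lemma Params.ac_ν : volume.restrict (Ioo P.rmin P.rmax) ≪ P.ν := by
  rw [Params.ν_eq]
  exact Measure.absolutelyContinuous_smul P.ν_scale_ne_zero

lemma Params.integrable_ν_iff {v : ℝ → ℂ} :
    Integrable v P.ν ↔ IntegrableOn v (Ioo P.rmin P.rmax) := by
  rw [Params.ν_eq]
  exact integrable_smul_measure P.ν_scale_ne_zero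
    (ENNReal.mul_ne_top ENNReal.ofReal_ne_top ENNReal.ofReal_ne_top)

instance : IsFiniteMeasure P.ν := by
  unfold Params.ν
  infer_instance

variable (P) in
/-- The functions in `L²` which only depend on the radius. -/
noncomputable def radialL2 : Submodule ℂ (L2 P) :=
  LinearMap.range (Lp.compMeasurePreservingₗᵢ (E := ℂ) (p := 2) ℂ Prod.fst
    (measurePreserving_radius (P := P))).toLinearMap

/-- The radial functions are the isometric image of the complete space `L²(ν)`. -/
lemma isClosed_radialL2 : IsClosed (radialL2 P : Set (L2 P)) := by
  have := (Lp.compMeasurePreservingₗᵢ (E := ℂ) (p := 2) ℂ Prod.fst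
    (measurePreserving_radius (P := P))).isometry.isClosedEmbedding.isClosed_range
  exact this

lemma ae_eq_comp_fst {u v : ℝ → ℂ} (h : u =ᵐ[P.ν] v) :
    (fun x : ℝ × ℝ => u x.1) =ᵐ[P.μ] fun x => v x.1 :=
  measurePreserving_radius.quasiMeasurePreserving.ae_eq_comp h

lemma exists_memLp_of_mem_radialL2 {w : L2 P} (h : w ∈ radialL2 P) :
    ∃ v : ℝ → ℂ, MemLp v 2 P.ν ∧ w =ᵐ[P.μ] fun x => v x.1 := by
  obtain ⟨v, rfl⟩ := h
  exact ⟨v, Lp.memLp v, Lp.coeFn_compMeasurePreserving v measurePreserving_radius⟩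

/-- No measurability of `v` is assumed. It is recovered from that of `w`, because `μ` is a multiple
of a product measure whose angular factor is nonzero. -/
lemma mem_radialL2_of_ae_eq {w : L2 P} {v : ℝ → ℂ} (h : w =ᵐ[P.μ] fun x => v x.1) :
    w ∈ radialL2 P := by
  have h0 : AEStronglyMeasurable (fun x : ℝ × ℝ => v x.1)
      ((volume.restrict (Ioo P.rmin P.rmax)).prod (volume.restrict (Ioo 0 (2 * Real.pi)))) := by
    have h1 : AEStronglyMeasurable (fun x : ℝ × ℝ => v x.1) P.μ :=
      (Lp.aestronglyMeasurable w).congr h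
    rw [Params.μ_eq] at h1
    exact h1.mono_ac (Measure.absolutelyContinuous_smul (ENNReal.ofReal_pos.2 P.scale_pos).ne')
  have hne : volume.restrict (Ioo 0 (2 * Real.pi)) ≠ 0 := by
    rw [Ne, Measure.restrict_eq_zero, Real.volume_Ioo, ENNReal.ofReal_eq_zero, not_le, sub_zero]
    exact Real.two_pi_pos
  have hv : AEStronglyMeasurable v P.ν :=
    (AEStronglyMeasurable.of_comp_fst h0 hne).mono_ac P.ν_ac
  have hm : MemLp v 2 P.ν := by
    have h2 : MemLp (v ∘ Prod.fst) 2 P.μ := (memLp_congr_ae h).1 (Lp.memLp w)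
    exact (memLp_map_measure_iff hv measurable_fst.aemeasurable).2 h2
  refine ⟨hm.toLp v, Lp.ext ?_⟩
  refine (Lp.coeFn_compMeasurePreserving _ measurePreserving_radius).trans ?_
  exact (ae_eq_comp_fst hm.coeFn_toLp).trans h.symm

lemma mem_radialL2_iff {w : L2 P} : w ∈ radialL2 P ↔ IsRadial w := by
  constructor
  · intro h
    obtain ⟨v, -, hv⟩ := exists_memLp_of_mem_radialL2 h
    exact ⟨v, hv⟩
  · rintro ⟨v, hv⟩
    exact mem_radialL2_of_ae_eq hv

lemma mulL2_mem_radialL2 {c : ℝ × ℝ → ℝ} (hc : ContinuousOn c P.Ωbar) {d : ℝ → ℝ}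
    (hd : ∀ x, c x = d x.1) {w : L2 P} (hw : w ∈ radialL2 P) : mulL2 c hc w ∈ radialL2 P := by
  obtain ⟨v, -, hv⟩ := exists_memLp_of_mem_radialL2 hw
  refine mem_radialL2_of_ae_eq (v := fun r => (d r : ℂ) * v r) ?_
  filter_upwards [coeFn_mulL2 hc w, hv] with x h1 h2
  rw [h1, h2, hd]

/-! ### Fubini -/

lemma integral_μ {h : ℝ × ℝ → ℂ} (hi : Integrable h P.μ) :
    ∫ x, h x ∂P.μ = ((1 / (2 * Real.pi * (P.rmax - P.rmin)) : ℝ) : ℂ) *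
      ∫ r in Ioo P.rmin P.rmax, ∫ ψ in (0)..(2 * Real.pi), h (r, ψ) := by
  rw [Params.μ_eq] at hi ⊢
  have hi' := (integrable_smul_measure (ENNReal.ofReal_pos.2 P.scale_pos).ne'
    ENNReal.ofReal_ne_top).1 hi
  rw [integral_smul_measure, ENNReal.toReal_ofReal P.scale_pos.le, Complex.real_smul,
    integral_prod _ hi']
  simp only [intervalIntegral.integral_of_le Real.two_pi_pos.le, integral_Ioc_eq_integral_Ioo]

lemma integral_μ_symm {h : ℝ × ℝ → ℂ} (hi : Integrable h P.μ) :
    ∫ x, h x ∂P.μ = ((1 / (2 * Real.pi * (P.rmax - P.rmin)) : ℝ) : ℂ) *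
      ∫ ψ in Ioo 0 (2 * Real.pi), ∫ r in P.rmin..P.rmax, h (r, ψ) := by
  rw [Params.μ_eq] at hi ⊢
  have hi' := (integrable_smul_measure (ENNReal.ofReal_pos.2 P.scale_pos).ne'
    ENNReal.ofReal_ne_top).1 hi
  rw [integral_smul_measure, ENNReal.toReal_ofReal P.scale_pos.le, Complex.real_smul,
    integral_prod_symm _ hi']
  simp only [intervalIntegral.integral_of_le P.rmin_lt_rmax.le, integral_Ioc_eq_integral_Ioo]

lemma integral_radial {u : L2 P} {v : ℝ → ℂ} (hv : u =ᵐ[P.μ] fun x => v x.1) {c : ℝ × ℝ → ℝ}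
    (hc : Continuous c) :
    ∫ x, u x * (c x : ℝ) ∂P.μ = ((1 / (2 * Real.pi * (P.rmax - P.rmin)) : ℝ) : ℂ) *
      ∫ r in Ioo P.rmin P.rmax, v r * ((∫ ψ in (0)..(2 * Real.pi), c (r, ψ) : ℝ) : ℂ) := by
  have h : (fun x => u x * (c x : ℂ)) =ᵐ[P.μ] fun x => v x.1 * (c x : ℂ) := by
    filter_upwards [hv] with x hx
    rw [hx]
  rw [integral_congr_ae h, integral_μ ((integrable_mul_of_test u hc).congr h)]
  simp only [intervalIntegral.integral_const_mul, intervalIntegral.integral_ofReal]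

/-- After Fubini the radial function leaves the inner integral, and `∂_ψ φ` integrates to zero over
a period. -/
lemma isWeakDeriv_angle_of_mem_radialL2 {u : L2 P} (hu : u ∈ radialL2 P) :
    IsWeakDeriv eψ u 0 := by
  obtain ⟨v, -, hv⟩ := exists_memLp_of_mem_radialL2 hu
  intro φ hφ
  have h0 : ∫ x, (0 : L2 P) x * (φ x : ℝ) ∂P.μ = 0 := by
    refine integral_eq_zero_of_ae ?_
    filter_upwards [Lp.coeFn_zero ℂ 2 P.μ] with x hx
    rw [hx]
    exact zero_mul _
  rw [h0, neg_zero, integral_radial hv (hφ.continuous_fderiv eψ)]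
  have h1 : ∀ r, ∫ ψ in (0)..(2 * Real.pi), fderiv ℝ φ (r, ψ) eψ = 0 := by
    intro r
    have hd : ∀ ψ, HasDerivAt (fun ψ => φ (r, ψ)) (fderiv ℝ φ (r, ψ) eψ) ψ := by
      intro ψ
      have h2 := (hφ.smooth.differentiable (by simp) (r, ψ)).hasFDerivAt
      exact h2.comp_hasDerivAt ψ ((hasDerivAt_const ψ r).prodMk (hasDerivAt_id ψ))
    rw [intervalIntegral.integral_eq_sub_of_hasDerivAt (fun ψ _ => hd ψ)]
    · have := hφ.periodic r 0
      rw [zero_add] at this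
      rw [this, sub_self]
    · exact ((hφ.continuous_fderiv eψ).comp (by fun_prop)).intervalIntegrable _ _
  simp [h1]

/-! ### Averages over the angle -/

/-- The average of a function over the angle. -/
noncomputable def angAvg (φ : ℝ × ℝ → ℝ) (x : ℝ × ℝ) : ℝ :=
  (2 * Real.pi)⁻¹ * ∫ ψ in (0)..(2 * Real.pi), φ (x.1, ψ)

lemma hasDerivAt_intervalIntegral {φ : ℝ × ℝ → ℝ} (hφ : ContDiff ℝ 1 φ) (T r : ℝ) :
    HasDerivAt (fun r => ∫ ψ in (0)..T, φ (r, ψ)) (∫ ψ in (0)..T, fderiv ℝ φ (r, ψ) er) r := by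
  have hc : Continuous fun x => fderiv ℝ φ x er :=
    (hφ.continuous_fderiv (by simp)).clm_apply continuous_const
  obtain ⟨C, hC⟩ := ((isCompact_closedBall r 1).prod (isCompact_uIcc (a := 0) (b := T))
    ).exists_bound_of_continuousOn hc.continuousOn
  refine (intervalIntegral.hasDerivAt_integral_of_dominated_loc_of_deriv_le
    (F := fun r ψ => φ (r, ψ)) (F' := fun r ψ => fderiv ℝ φ (r, ψ) er)
    (s := Metric.closedBall r 1) (bound := fun _ => C) (Metric.closedBall_mem_nhds r one_pos)
    (Eventually.of_forall fun x => ?_) ?_ ?_ ?_ ?_ ?_).2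
  · exact (hφ.continuous.comp (by fun_prop)).aestronglyMeasurable
  · exact (hφ.continuous.comp (by fun_prop)).intervalIntegrable _ _
  · exact (hc.comp (by fun_prop)).aestronglyMeasurable
  · exact Eventually.of_forall fun ψ hψ x hx => hC (x, ψ) ⟨hx, uIoc_subset_uIcc hψ⟩
  · exact intervalIntegrable_const
  · refine Eventually.of_forall fun ψ _ x _ => ?_
    have h2 := (hφ.differentiable (by simp) (x, ψ)).hasFDerivAt
    exact h2.comp_hasDerivAt x ((hasDerivAt_id x).prodMk (hasDerivAt_const x ψ))

/-- The derivative is an integral of the same kind with `∂_r φ` in place of `φ`, so the induction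
runs over all smooth `φ` at once. -/
lemma contDiff_intervalIntegral {φ : ℝ × ℝ → ℝ} (hφ : ContDiff ℝ ∞ φ) (T : ℝ) :
    ContDiff ℝ ∞ fun r => ∫ ψ in (0)..T, φ (r, ψ) := by
  rw [contDiff_infty]
  intro n
  induction n generalizing φ with
  | zero =>
    rw [Nat.cast_zero, contDiff_zero, continuous_iff_continuousAt]
    exact fun r => (hasDerivAt_intervalIntegral (hφ.of_le (by simp)) T r).continuousAt
  | succ n ih =>
    have hd := hasDerivAt_intervalIntegral (hφ.of_le (by simp)) T
    rw [Nat.cast_succ, contDiff_succ_iff_deriv]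
    refine ⟨fun r => (hd r).differentiableAt, by simp, ?_⟩
    rw [show deriv _ = _ from funext fun r => (hd r).deriv]
    exact ih ((hφ.fderiv_right (m := ∞) (by simp)).clm_apply contDiff_const)

/-- Since averages are again test functions, they can be inserted into the definition of a weak
derivative. -/
lemma IsTest.angAvg {φ : ℝ × ℝ → ℝ} (h : IsTest P φ) : IsTest P (angAvg φ) := by
  refine ⟨?_, fun r ψ => rfl, ?_⟩
  · exact contDiff_const.mul ((contDiff_intervalIntegral h.smooth _).comp contDiff_fst)
  · obtain ⟨K, hK, hKc, hz⟩ := h.support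
    exact ⟨K, hK, hKc, fun r ψ hr => by simp [ShearHopf.angAvg, hz r _ hr]⟩

lemma IsTest.fderiv_angAvg {φ : ℝ × ℝ → ℝ} (h : IsTest P φ) (x : ℝ × ℝ) :
    fderiv ℝ (ShearHopf.angAvg φ) x er = ShearHopf.angAvg (fun y => fderiv ℝ φ y er) x := by
  have h1 := (hasDerivAt_intervalIntegral (h.smooth.of_le (by simp)) (2 * Real.pi) x.1).const_mul
    (2 * Real.pi)⁻¹
  have h2 : HasFDerivAt (ShearHopf.angAvg φ) _ x :=
    h1.hasFDerivAt.comp (f := Prod.fst) x hasFDerivAt_fst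
  rw [h2.fderiv]
  simp [er, ShearHopf.angAvg]

lemma continuous_angAvg {c : ℝ × ℝ → ℝ} (hc : Continuous c) : Continuous (angAvg c) := by
  have : Continuous fun r : ℝ => ∫ ψ in (0)..(2 * Real.pi), c (r, ψ) :=
    intervalIntegral.continuous_parametric_intervalIntegral_of_continuous'
      (f := fun r ψ => c (r, ψ)) hc _ _
  exact continuous_const.mul (this.comp continuous_fst)

lemma integral_mul_angAvg {u : L2 P} (hu : u ∈ radialL2 P) {c : ℝ × ℝ → ℝ} (hc : Continuous c) :
    ∫ x, u x * (angAvg c x : ℝ) ∂P.μ = ∫ x, u x * (c x : ℝ) ∂P.μ := by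
  obtain ⟨v, -, hv⟩ := exists_memLp_of_mem_radialL2 hu
  rw [integral_radial hv hc, integral_radial hv (continuous_angAvg hc)]
  have hp : (2 * Real.pi) ≠ 0 := Real.two_pi_pos.ne'
  have h : ∀ r, ∫ ψ in (0)..(2 * Real.pi), angAvg c (r, ψ)
      = ∫ ψ in (0)..(2 * Real.pi), c (r, ψ) := by
    intro r
    simp only [angAvg]
    rw [intervalIntegral.integral_const, sub_zero, smul_eq_mul, mul_inv_cancel_left₀ hp]
  simp only [h]

/-- A function orthogonal to the radial functions integrates to zero against averages. -/
lemma integral_mul_angAvg_of_mem_orthogonal {z : L2 P} (hz : z ∈ (radialL2 P)ᗮ) {c : ℝ × ℝ → ℝ}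
    (hc : Continuous c) : ∫ x, z x * (angAvg c x : ℝ) ∂P.μ = 0 := by
  have hm : MemLp (fun x => (angAvg c x : ℂ)) 2 P.μ := by
    have h1 := memLp_mul (continuous_angAvg hc).continuousOn
      ((memLp_const (1 : ℂ)).toLp (fun _ => (1 : ℂ)) : L2 P)
    refine (memLp_congr_ae ?_).1 h1
    filter_upwards [(memLp_const (μ := P.μ) (p := 2) (1 : ℂ)).coeFn_toLp] with x hx
    rw [hx, mul_one]
  have hr : hm.toLp _ ∈ radialL2 P :=
    mem_radialL2_of_ae_eq (v := fun r => (angAvg c (r, 0) : ℂ)) hm.coeFn_toLp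
  have h0 := (Submodule.mem_orthogonal _ _).1 hz _ hr
  rw [L2.inner_def] at h0
  rw [← h0]
  refine integral_congr_ae ?_
  filter_upwards [hm.coeFn_toLp] with x hx
  -- The average is real, so the conjugation in the inner product has no effect.
  rw [hx, RCLike.inner_apply, Complex.conj_ofReal]

lemma integral_add_mul_test (p q : L2 P) {c : ℝ × ℝ → ℝ} (hc : Continuous c) :
    ∫ x, (p + q) x * (c x : ℝ) ∂P.μ
      = ∫ x, p x * (c x : ℝ) ∂P.μ + ∫ x, q x * (c x : ℝ) ∂P.μ := by
  rw [← integral_add (integrable_mul_of_test p hc) (integrable_mul_of_test q hc)]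
  refine integral_congr_ae ?_
  filter_upwards [Lp.coeFn_add p q] with x hx
  rw [hx, Pi.add_apply, add_mul]

/-- Split `w` into a radial part and a part orthogonal to the radial functions. The radial part
satisfies the identity automatically, and the orthogonal part annihilates averages, hence all test
functions, so it vanishes. -/
lemma mem_radialL2_of_forall_test {w : L2 P} (h : ∀ φ, IsTest P φ →
    ∫ x, w x * (φ x : ℝ) ∂P.μ = ∫ x, w x * (angAvg φ x : ℝ) ∂P.μ) : w ∈ radialL2 P := by
  have : CompleteSpace (radialL2 P) := isClosed_radialL2.completeSpace_coe
  obtain ⟨y, hy, z, hz, rfl⟩ := (radialL2 P).exists_add_mem_mem_orthogonal w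
  have hz0 : z = 0 := by
    refine eq_zero_of_forall_test z fun φ hφ => ?_
    have h1 := h φ hφ
    rw [integral_add_mul_test _ _ hφ.smooth.continuous,
      integral_add_mul_test _ _ hφ.angAvg.smooth.continuous,
      integral_mul_angAvg hy hφ.smooth.continuous,
      integral_mul_angAvg_of_mem_orthogonal hz hφ.smooth.continuous, add_zero] at h1
    simpa using h1
  rwa [hz0, add_zero]

/-- The weak radial derivative of a radial function is radial. -/
lemma IsWeakDeriv.mem_radialL2 {u q : L2 P} (h : IsWeakDeriv er u q) (hu : u ∈ radialL2 P) :
    q ∈ radialL2 P := by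
  refine mem_radialL2_of_forall_test fun φ hφ => ?_
  have h1 := h φ hφ
  have h2 := h _ hφ.angAvg
  simp only [hφ.fderiv_angAvg] at h2
  -- Because `u` is radial, it pairs with `∂_r φ` and with its average alike; hence `q` pairs
  -- equally with `φ` and its average.
  rw [integral_mul_angAvg hu (hφ.continuous_fderiv er), h1] at h2
  exact neg_injective h2

/-- The weak radial derivative of the lift of an absolutely continuous function. -/
lemma isWeakDeriv_radius_of_eq_integral {u q : ℝ → ℂ} {U Q : L2 P}
    (hu : U =ᵐ[P.μ] fun x => u x.1) (hq : Q =ᵐ[P.μ] fun x => q x.1)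
    (hparts : ∀ η : ℝ → ℝ, ContDiff ℝ 1 η → η P.rmin = 0 → η P.rmax = 0 →
      ∫ r in P.rmin..P.rmax, u r * ((deriv η r : ℝ) : ℂ) = -∫ r in P.rmin..P.rmax, q r * (η r : ℂ)) :
    IsWeakDeriv er U Q := by
  intro φ hφ
  have h1 : (fun x => U x * (fderiv ℝ φ x er : ℂ)) =ᵐ[P.μ]
      fun x => u x.1 * (fderiv ℝ φ x er : ℂ) := by
    filter_upwards [hu] with x hx
    rw [hx]
  have h2 : (fun x => Q x * (φ x : ℂ)) =ᵐ[P.μ] fun x => q x.1 * (φ x : ℂ) := by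
    filter_upwards [hq] with x hx
    rw [hx]
  rw [integral_congr_ae h1, integral_congr_ae h2,
    integral_μ_symm ((integrable_mul_of_test _ (hφ.continuous_fderiv er)).congr h1),
    integral_μ_symm ((integrable_mul_of_test _ hφ.smooth.continuous).congr h2), ← mul_neg,
    ← integral_neg]
  congr 2
  funext ψ
  have hd : ∀ r, HasDerivAt (fun r => φ (r, ψ)) (fderiv ℝ φ (r, ψ) er) r := by
    intro r
    have h2 := (hφ.smooth.differentiable (by simp) (r, ψ)).hasFDerivAt
    exact h2.comp_hasDerivAt r ((hasDerivAt_id r).prodMk (hasDerivAt_const r ψ))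
  -- For fixed `ψ` the slice `φ(·, ψ)` vanishes at both endpoints, since `K` lies in the open
  -- interval.
  obtain ⟨K, hK, -, hz⟩ := hφ.support
  have := hparts (fun r => φ (r, ψ)) ((hφ.smooth.of_le (by simp)).comp (by fun_prop))
    (hz _ _ fun h => (hK h).1.false) (hz _ _ fun h => (hK h).2.false)
  simpa only [fun r => (hd r).deriv] using this

/-! ### Linear Volterra equations and integration by parts -/

/-- Relative to the weight `exp (M t)`, integration gains a factor `1 / M`. This makes the Volterra
map a contraction on the whole interval, whatever its length. -/
lemma intervalIntegral_exp_le {M : ℝ} (hM : 0 < M) (a t : ℝ) :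
    ∫ s in a..t, Real.exp (M * s) ≤ Real.exp (M * t) / M := by
  have h : ∀ s, HasDerivAt (fun s => Real.exp (M * s) / M) (Real.exp (M * s)) s := by
    intro s
    have := (((hasDerivAt_id s).const_mul M).exp).div_const M
    simpa [hM.ne'] using this
  rw [intervalIntegral.integral_eq_sub_of_hasDerivAt (fun s _ => h s)
    ((by fun_prop : Continuous fun s => Real.exp (M * s)).intervalIntegrable _ _)]
  have : 0 ≤ Real.exp (M * a) / M := by positivity
  linarith

/-- A linear Volterra integral equation on a compact interval has a continuous solution. -/
lemma exists_volterra_solution {E : Type*} [NormedAddCommGroup E] [NormedSpace ℝ E]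
    [CompleteSpace E] {a b : ℝ} (hab : a ≤ b) {A : ℝ → E →L[ℝ] E} (hA : Continuous A)
    {G : ℝ → E} (hG : ContinuousOn G (Icc a b)) :
    ∃ y : ℝ → E, Continuous y ∧ ∀ t ∈ Icc a b, y t = G t + ∫ s in a..t, A s (y s) := by
  obtain ⟨K, hK⟩ := (isCompact_Icc (a := a) (b := b)).exists_bound_of_continuousOn hA.continuousOn
  have hK0 : 0 ≤ K := (norm_nonneg _).trans (hK a ⟨le_rfl, hab⟩)
  set M := K + 1 with hM
  have hM0 : 0 < M := by linarith
  -- The unknown is `y = exp (M t) w`, so the sup norm of `w` is a weighted norm of `y`; in it the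
  -- contraction factor is `K / M = K / (K + 1)`.
  let y : C(Icc a b, E) → ℝ → E := fun w t => Real.exp (M * t) • w (projIcc a b hab t)
  have hy : ∀ w, Continuous (y w) := fun w =>
    (by fun_prop : Continuous fun t => Real.exp (M * t)).smul
      (w.continuous.comp continuous_projIcc)
  have hi : ∀ w, Continuous fun s => A s (y w s) := fun w => hA.clm_apply (hy w)
  have hc : ∀ w : C(Icc a b, E), Continuous fun t : Icc a b =>
      Real.exp (-(M * t)) • (G t + ∫ s in a..t, A s (y w s)) := by
    intro w
    have h1 : Continuous fun t : Icc a b => G t := continuousOn_iff_continuous_domRestrict.1 hG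
    have h2 : Continuous fun t : ℝ => ∫ s in a..t, A s (y w s) :=
      intervalIntegral.continuous_primitive (fun _ _ => (hi w).intervalIntegrable _ _) a
    exact (by fun_prop : Continuous fun t : Icc a b => Real.exp (-(M * t))).smul
      (h1.add (h2.comp continuous_subtype_val))
  let T : C(Icc a b, E) → C(Icc a b, E) := fun w => ⟨_, hc w⟩
  have hT : ContractingWith (K / M).toNNReal T := by
    constructor
    · rw [Real.toNNReal_lt_one, div_lt_one hM0]
      linarith
    · refine LipschitzWith.of_dist_le_mul fun w z => ?_
      rw [Real.coe_toNNReal _ (by positivity)]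
      refine (ContinuousMap.dist_le (by positivity)).2 fun t => ?_
      have hle : ∀ s ∈ Ioc a (t : ℝ), ‖A s (y w s) - A s (y z s)‖
          ≤ K * dist w z * Real.exp (M * s) := by
        intro s hs
        rw [← map_sub]
        have h1 := hK s ⟨hs.1.le, hs.2.trans t.2.2⟩
        have h2 : ‖y w s - y z s‖ ≤ Real.exp (M * s) * dist w z := by
          simp only [y, ← smul_sub, norm_smul, Real.norm_eq_abs, Real.abs_exp, ← dist_eq_norm]
          gcongr
          exact ContinuousMap.dist_apply_le_dist _
        calc ‖A s (y w s - y z s)‖ ≤ ‖A s‖ * ‖y w s - y z s‖ := (A s).le_opNorm _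
          _ ≤ K * (Real.exp (M * s) * dist w z) := by gcongr
          _ = K * dist w z * Real.exp (M * s) := by ring
      have h3 : ‖∫ s in a..t, (A s (y w s) - A s (y z s))‖
          ≤ ∫ s in a..t, K * dist w z * Real.exp (M * s) :=
        intervalIntegral.norm_integral_le_of_norm_le t.2.1
          (Eventually.of_forall fun s hs => hle s hs)
          ((by fun_prop : Continuous fun s => K * dist w z * Real.exp (M * s)).intervalIntegrable
            _ _)
      rw [intervalIntegral.integral_const_mul, intervalIntegral.integral_sub
        ((hi w).intervalIntegrable _ _) ((hi z).intervalIntegrable _ _)] at h3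
      rw [dist_eq_norm]
      change ‖Real.exp (-(M * t)) • (G t + ∫ s in a..t, A s (y w s))
        - Real.exp (-(M * t)) • (G t + ∫ s in a..t, A s (y z s))‖ ≤ _
      rw [← smul_sub, add_sub_add_left_eq_sub, norm_smul, Real.norm_eq_abs, Real.abs_exp]
      calc Real.exp (-(M * t)) * ‖(∫ s in a..t, A s (y w s)) - ∫ s in a..t, A s (y z s)‖
          ≤ Real.exp (-(M * t)) * (K * dist w z * (Real.exp (M * t) / M)) := by
            gcongr
            exact h3.trans (by gcongr; exact intervalIntegral_exp_le hM0 _ _)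
        _ = K / M * dist w z := by
            rw [Real.exp_neg]
            field_simp
  have : Nonempty C(Icc a b, E) := ⟨0⟩
  set w := hT.fixedPoint T
  have hw : T w = w := hT.fixedPoint_isFixedPt
  refine ⟨y w, hy w, fun t ht => ?_⟩
  have h1 : w ⟨t, ht⟩ = Real.exp (-(M * t)) • (G t + ∫ s in a..t, A s (y w s)) :=
    (DFunLike.congr_fun hw ⟨t, ht⟩).symm
  have h2 : y w t = Real.exp (M * t) • w ⟨t, ht⟩ := by
    simp only [y, projIcc_of_mem hab ht]
  rw [h2, h1, smul_smul, ← Real.exp_add, add_neg_cancel, Real.exp_zero, one_smul]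

/-- Integration by parts for a primitive of an integrable function. -/
lemma integral_mul_deriv_of_eq_integral {a b : ℝ} (hab : a ≤ b) {u q : ℝ → ℂ} {c : ℂ}
    (hq : IntervalIntegrable q volume a b) (hu : ∀ t ∈ Icc a b, u t = c + ∫ s in a..t, q s)
    {η : ℝ → ℝ} (hη : ContDiff ℝ 1 η) (ha : η a = 0) (hb : η b = 0) :
    ∫ r in a..b, u r * ((deriv η r : ℝ) : ℂ) = -∫ r in a..b, q r * (η r : ℂ) := by
  have hdc : Continuous fun r => ((deriv η r : ℝ) : ℂ) :=
    Complex.continuous_ofReal.comp (hη.continuous_deriv (by simp))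
  have hftc : ∀ s t, ∫ r in s..t, ((deriv η r : ℝ) : ℂ) = η t - η s := by
    intro s t
    rw [intervalIntegral.integral_ofReal, intervalIntegral.integral_deriv_eq_sub
      (fun x _ => hη.differentiable (by simp) x)
      ((hη.continuous_deriv (by simp)).intervalIntegrable _ _)]
    push_cast
    rfl
  -- Integrating `q(s) η'(r)` over the triangle `s ≤ r` in the two orders gives the two sides: `s`
  -- first produces `(u - c) η'`, `r` first produces `q(s) (η(b) - η(s))`.
  let F : ℝ → ℝ → ℂ := fun r s => {s | s ≤ r}.indicator q s * ((deriv η r : ℝ) : ℂ)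
  have hF : IntegrableOn F.uncurry (uIoc a b ×ˢ uIoc a b) := by
    have h1 : Integrable (fun x : ℝ × ℝ => ((deriv η x.1 : ℝ) : ℂ) * q x.2)
        ((volume.restrict (uIoc a b)).prod (volume.restrict (uIoc a b))) :=
      ((hdc.intervalIntegrable a b).def').mul_prod hq.def'
    have h2 := h1.indicator (measurableSet_le measurable_snd measurable_fst)
    rw [Measure.prod_restrict, ← Measure.volume_eq_prod] at h2
    refine h2.congr (Eventually.of_forall fun x => ?_)
    by_cases h : x.2 ≤ x.1 <;> simp [F, Function.uncurry, indicator, h, mul_comm]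
  have hswap := intervalIntegral_intervalIntegral_swap hF
  have hl : ∫ r in a..b, ∫ s in a..b, F r s
      = ∫ r in a..b, u r * ((deriv η r : ℝ) : ℂ) := by
    have h1 : ∫ r in a..b, u r * ((deriv η r : ℝ) : ℂ)
        = ∫ r in a..b, (c * ((deriv η r : ℝ) : ℂ) + ∫ s in a..b, F r s) := by
      refine intervalIntegral.integral_congr fun r hr => ?_
      rw [uIcc_of_le hab] at hr
      simp only [F]
      rw [intervalIntegral.integral_mul_const, intervalIntegral.integral_indicator hr, hu r hr,
        add_mul]
    have hFi : IntervalIntegrable (fun r => ∫ s in a..b, F r s) volume a b := by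
      have h2 : ContinuousOn (fun r => (∫ s in a..r, q s) * ((deriv η r : ℝ) : ℂ)) (uIcc a b) :=
        (intervalIntegral.continuousOn_primitive_interval' hq left_mem_uIcc).mul hdc.continuousOn
      refine h2.intervalIntegrable.congr fun r hr => ?_
      rw [uIoc_of_le hab] at hr
      simp only [F]
      rw [intervalIntegral.integral_mul_const,
        intervalIntegral.integral_indicator (Ioc_subset_Icc_self hr)]
    rw [h1, intervalIntegral.integral_add ((hdc.const_mul c).intervalIntegrable _ _) hFi,
      intervalIntegral.integral_const_mul, hftc, ha, hb]
    simp
  have hr : ∫ s in a..b, ∫ r in a..b, F r s = -∫ s in a..b, q s * (η s : ℂ) := by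
    rw [← intervalIntegral.integral_neg]
    refine intervalIntegral.integral_congr fun s hs => ?_
    rw [uIcc_of_le hab] at hs
    have h1 : ∀ r, F r s = q s * (Ici s).indicator (fun r => ((deriv η r : ℝ) : ℂ)) r := by
      intro r
      by_cases h : s ≤ r <;> simp [F, indicator, h]
    have hind : ∀ t t', IntervalIntegrable ((Ici s).indicator fun r => ((deriv η r : ℝ) : ℂ))
        volume t t' := fun t t' => by
      rw [intervalIntegrable_iff]
      exact (hdc.intervalIntegrable t t').def'.indicator measurableSet_Ici
    -- On `[a, s]` the indicator is nonzero at most at the single point `s`.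
    have h2 : ∫ r in a..s, (Ici s).indicator (fun r => ((deriv η r : ℝ) : ℂ)) r = 0 := by
      refine intervalIntegral.integral_zero_ae ?_
      filter_upwards [Measure.ae_ne volume s] with r hr hr'
      rw [uIoc_of_le hs.1] at hr'
      exact indicator_of_notMem (fun h => hr (le_antisymm hr'.2 h)) _
    have h3 : ∫ r in s..b, (Ici s).indicator (fun r => ((deriv η r : ℝ) : ℂ)) r
        = ∫ r in s..b, ((deriv η r : ℝ) : ℂ) := by
      refine intervalIntegral.integral_congr fun r hr => ?_
      rw [uIcc_of_le hs.2] at hr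
      exact indicator_of_mem hr.1 _
    simp only [h1]
    rw [intervalIntegral.integral_const_mul,
      ← intervalIntegral.integral_add_adjacent_intervals (hind a s) (hind s b), h2, h3, hftc, hb]
    simp
  rw [← hl, hswap, hr]

/-! ### Radial solutions of the ordinary differential equation -/

variable (P) in
/-- `u` solves `(σ² / 2) u'' + f u' - lam u = w` on `[rmin, rmax]` with `u(rmin) = 0` and
`u'(rmin) = c`, where `v = u'` and `q = u''`. -/
structure IsRadialSolution (lam : ℂ) (w : ℝ → ℂ) (c : ℂ) (u v q : ℝ → ℂ) : Prop where
  continuous_u : Continuous u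
  continuous_v : Continuous v
  memLp : MemLp q 2 P.ν
  eq_u : ∀ t ∈ Icc P.rmin P.rmax, u t = ∫ s in P.rmin..t, v s
  eq_v : ∀ t ∈ Icc P.rmin P.rmax, v t = c + ∫ s in P.rmin..t, q s
  eqn : ∀ t ∈ Icc P.rmin P.rmax,
    ((P.σ ^ 2 / 2 : ℝ) : ℂ) * q t + (P.f (t, 0) : ℂ) * v t - lam * u t = w t

lemma intervalIntegrable_of_memLp {q : ℝ → ℂ} (h : MemLp q 2 P.ν) {t : ℝ}
    (ht : t ∈ Icc P.rmin P.rmax) : IntervalIntegrable q volume P.rmin t := by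
  have h1 := P.integrable_ν_iff.1 (h.integrable (by norm_num))
  rw [intervalIntegrable_iff_integrableOn_Ioo_of_le ht.1]
  exact h1.mono_set (Ioo_subset_Ioo_right ht.2)

lemma memLp_ν_of_continuousOn {v : ℝ → ℂ} (hv : ContinuousOn v (Icc P.rmin P.rmax)) :
    MemLp v 2 P.ν := by
  obtain ⟨C, hC⟩ := (isCompact_Icc (a := P.rmin) (b := P.rmax)).exists_bound_of_continuousOn hv
  refine MemLp.of_bound ?_ C ?_
  · exact ((hv.mono Ioo_subset_Icc_self).aestronglyMeasurable measurableSet_Ioo).mono_ac P.ν_ac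
  · filter_upwards [P.ν_ac.ae_le (ae_restrict_mem measurableSet_Ioo)] with t ht
    exact hC t (Ioo_subset_Icc_self ht)

/-- The equation is a first-order system for `(u, u')`. As `w` is only square integrable, it enters
through its continuous primitive in the Volterra equation. Then `q` is defined by solving the
equation for the second derivative, so the equation holds at every point. -/
lemma exists_isRadialSolution (lam : ℂ) {w : ℝ → ℂ} (hw : MemLp w 2 P.ν) (c : ℂ) :
    ∃ u v q, IsRadialSolution P lam w c u v q := by
  have hab := P.rmin_lt_rmax.le
  set k : ℂ := ((2 / P.σ ^ 2 : ℝ) : ℂ) with hk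
  -- Clamping the argument to `[rmin, rmax]` keeps the coefficient continuous on all of `ℝ`, away
  -- from the singularity at `r = 0`.
  let f : ℝ → ℝ := fun t => P.f (projIcc P.rmin P.rmax hab t, 0)
  have hfc : Continuous f := by
    refine P.continuousOn_f.comp_continuous
      ((continuous_subtype_val.comp continuous_projIcc).prodMk continuous_const) fun t => ?_
    exact ⟨(projIcc P.rmin P.rmax hab t).2, le_rfl, Real.two_pi_pos.le⟩
  have hf : ∀ t ∈ Icc P.rmin P.rmax, f t = P.f (t, 0) := fun t ht => by
    simp only [f, projIcc_of_mem hab ht]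
  let A₀ : ℂ × ℂ →L[ℝ] ℂ × ℂ := ((ContinuousLinearMap.snd ℂ ℂ ℂ).prod
    ((k * lam) • ContinuousLinearMap.fst ℂ ℂ ℂ)).restrictScalars ℝ
  let A₁ : ℂ × ℂ →L[ℝ] ℂ × ℂ := ((0 : ℂ × ℂ →L[ℂ] ℂ).prod
    (-k • ContinuousLinearMap.snd ℂ ℂ ℂ)).restrictScalars ℝ
  have hA : ∀ t y, (A₀ + f t • A₁) y = (y.2, k * (lam * y.1 - f t * y.2)) := by
    intro t y
    refine Prod.ext ?_ ?_
    · simp [A₀, A₁]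
    · simp [A₀, A₁]
      ring
  have hwi : IntervalIntegrable w volume P.rmin P.rmax :=
    intervalIntegrable_of_memLp hw ⟨hab, le_rfl⟩
  have hG : ContinuousOn (fun t => ((0 : ℂ), c + k * ∫ s in P.rmin..t, w s))
      (Icc P.rmin P.rmax) := by
    have := intervalIntegral.continuousOn_primitive_interval' hwi left_mem_uIcc
    rw [uIcc_of_le hab] at this
    fun_prop
  obtain ⟨y, hyc, hy⟩ := exists_volterra_solution hab
    (A := fun t => A₀ + f t • A₁) (by fun_prop) hG
  simp only [hA] at hy
  have hq : MemLp (fun t => k * (w t + (lam * (y t).1 - f t * (y t).2))) 2 P.ν := by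
    refine (hw.add (memLp_ν_of_continuousOn ?_)).const_mul k
    fun_prop
  have hint : ∀ t, IntervalIntegrable (fun s => ((y s).2, k * (lam * (y s).1 - f s * (y s).2)))
      volume P.rmin t := fun t => by
    refine Continuous.intervalIntegrable ?_ _ _
    fun_prop
  refine ⟨fun t => (y t).1, fun t => (y t).2, _, by fun_prop, by fun_prop, hq, ?_, ?_, ?_⟩
  · intro t ht
    rw [hy t ht]
    simpa using ((ContinuousLinearMap.fst ℝ ℂ ℂ).intervalIntegral_comp_comm (hint t)).symm
  · intro t ht
    have h1 := (ContinuousLinearMap.snd ℝ ℂ ℂ).intervalIntegral_comp_comm (hint t)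
    simp only [ContinuousLinearMap.coe_snd'] at h1
    have h2 : Continuous fun s => k * (lam * (y s).1 - f s * (y s).2) := by fun_prop
    change (y t).2 = _
    rw [hy t ht]
    simp only [Prod.snd_add, ← h1, mul_add]
    rw [intervalIntegral.integral_add ((intervalIntegrable_of_memLp hw ht).const_mul k)
      (by simpa only [mul_add] using h2.intervalIntegrable _ _),
      intervalIntegral.integral_const_mul, intervalIntegral.integral_const_mul, add_assoc]
  · intro t ht
    have hσ : (P.σ : ℂ) ≠ 0 := by exact_mod_cast P.σ_pos.ne'
    simp only [hf t ht, hk]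
    push_cast
    field_simp
    ring

namespace IsRadialSolution

variable {lam c c' : ℂ} {w w' u v q u' v' q' : ℝ → ℂ}

lemma add (h : IsRadialSolution P lam w c u v q) (h' : IsRadialSolution P lam w' c' u' v' q') :
    IsRadialSolution P lam (fun t => w t + w' t) (c + c') (fun t => u t + u' t)
      (fun t => v t + v' t) (fun t => q t + q' t) where
  continuous_u := h.continuous_u.add h'.continuous_u
  continuous_v := h.continuous_v.add h'.continuous_v
  memLp := h.memLp.add h'.memLp
  eq_u t ht := by
    rw [h.eq_u t ht, h'.eq_u t ht, intervalIntegral.integral_add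
      (h.continuous_v.intervalIntegrable _ _) (h'.continuous_v.intervalIntegrable _ _)]
  eq_v t ht := by
    rw [h.eq_v t ht, h'.eq_v t ht, intervalIntegral.integral_add
      (intervalIntegrable_of_memLp h.memLp ht) (intervalIntegrable_of_memLp h'.memLp ht)]
    ring
  eqn t ht := by
    rw [← h.eqn t ht, ← h'.eqn t ht]
    ring

lemma const_mul (z : ℂ) (h : IsRadialSolution P lam w c u v q) :
    IsRadialSolution P lam (fun t => z * w t) (z * c) (fun t => z * u t)
      (fun t => z * v t) (fun t => z * q t) where
  continuous_u := continuous_const.mul h.continuous_u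
  continuous_v := continuous_const.mul h.continuous_v
  memLp := h.memLp.const_mul z
  eq_u t ht := by rw [h.eq_u t ht, intervalIntegral.integral_const_mul]
  eq_v t ht := by rw [h.eq_v t ht, intervalIntegral.integral_const_mul, mul_add]
  eqn t ht := by
    rw [← h.eqn t ht]
    ring

/-- The initial slope of a solution which vanishes almost everywhere is zero. -/
lemma slope_eq_zero (h : IsRadialSolution P lam w c u v q) (h0 : u =ᵐ[P.ν] 0) : c = 0 := by
  have hab := P.rmin_lt_rmax
  -- By continuity `u` vanishes on the closed interval, so `v = u'` vanishes inside it and, again by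
  -- continuity, at `rmin`, where its value is `c`.
  have h1 : ∀ t ∈ Icc P.rmin P.rmax, u t = 0 := by
    have h2 : u =ᵐ[volume.restrict (Icc P.rmin P.rmax)] 0 := by
      rw [← Measure.restrict_congr_set Ioo_ae_eq_Icc]
      exact P.ac_ν.ae_le h0
    exact Measure.eqOn_Icc_of_ae_eq volume hab.ne h2 h.continuous_u.continuousOn
      continuousOn_const
  have hv : ∀ t ∈ Ioo P.rmin P.rmax, v t = 0 := by
    intro t ht
    have hd : HasDerivAt (fun t => ∫ s in P.rmin..t, v s) (v t) t :=
      intervalIntegral.integral_hasDerivAt_right (h.continuous_v.intervalIntegrable _ _)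
        (h.continuous_v.stronglyMeasurableAtFilter _ _) h.continuous_v.continuousAt
    refine hd.unique ((hasDerivAt_const t (0 : ℂ)).congr_of_eventuallyEq ?_)
    filter_upwards [Ioo_mem_nhds ht.1 ht.2] with s hs
    rw [← h.eq_u s (Ioo_subset_Icc_self hs), h1 s (Ioo_subset_Icc_self hs)]
  have h3 : v P.rmin = 0 := by
    have hcl : P.rmin ∈ closure (Ioo P.rmin P.rmax) := by
      rw [closure_Ioo hab.ne]
      exact left_mem_Icc.2 hab.le
    exact closure_minimal (t := {t | v t = 0}) hv
      (isClosed_eq h.continuous_v continuous_const) hcl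
  have h4 := h.eq_v P.rmin ⟨le_rfl, hab.le⟩
  rwa [h3, intervalIntegral.integral_same, add_zero, eq_comm] at h4

end IsRadialSolution

/-! ### The operator on radial functions -/

lemma dψ_eq_zero_of_radial {u : X P} (hu : X.toL2 P u ∈ radialL2 P) : X.dψ u = 0 :=
  (isWeakDeriv_angle_of_mem_radialL2 hu).wderiv_eq

/-- All angular derivatives of `u` vanish, which removes the term containing `g`, the only
coefficient that depends on `ψ`. -/
lemma opL_of_radial {u : X P} (hu : X.toL2 P u ∈ radialL2 P) :
    opL u = ((P.σ ^ 2 / 2 : ℝ) : ℂ) • X.drr u + mulL2 P.f P.continuousOn_f (X.dr u) := by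
  have h1 : X.dψψ u = 0 := by
    change wderiv eψ (X.dψ u) = 0
    rw [dψ_eq_zero_of_radial hu]
    exact (isWeakDeriv_zero eψ).wderiv_eq
  have h2 : opL u = ((P.σ ^ 2 / 2 : ℝ) : ℂ) •
      (X.drr u + mulL2 cLap P.continuousOn_cLap (X.dψψ u))
      + mulL2 P.f P.continuousOn_f (X.dr u) + mulL2 P.g P.continuousOn_g (X.dψ u) := rfl
  rw [h2, h1, dψ_eq_zero_of_radial hu, map_zero, map_zero, add_zero, add_zero]

lemma opL_mem_radialL2 {u : X P} (hu : X.toL2 P u ∈ radialL2 P) : opL u ∈ radialL2 P := by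
  have h1 : X.dr u ∈ radialL2 P := (isWeakDeriv_wderiv u.memH2.1.1).mem_radialL2 hu
  have h2 : X.drr u ∈ radialL2 P := (isWeakDeriv_wderiv u.memH2.2.1.1).mem_radialL2 h1
  rw [opL_of_radial hu]
  exact Submodule.add_mem _ (Submodule.smul_mem _ _ h2)
    (mulL2_mem_radialL2 _ (d := fun r => P.f (r, 0)) (fun _ => rfl) h1)

variable (P) in
/-- The pairs whose function is radial. -/
noncomputable def radialX : Submodule ℂ (XC P) :=
  (radialL2 P).comap ((X.toL2 P) ∘ₗ (WithLp.fstL 2 ℂ (X P) ℂ).toLinearMap)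

variable (P) in
/-- The pairs whose function is radial. -/
noncomputable def radialY : Submodule ℂ (YC P) :=
  (radialL2 P).comap (WithLp.fstL 2 ℂ (L2 P) ℂ).toLinearMap

lemma mem_radialX {p : XC P} : p ∈ radialX P ↔ X.toL2 P p.fst ∈ radialL2 P := Iff.rfl

lemma mem_radialY {p : YC P} : p ∈ radialY P ↔ p.fst ∈ radialL2 P := Iff.rfl

lemma isClosed_radialY : IsClosed (radialY P : Set (YC P)) :=
  isClosed_radialL2.preimage (WithLp.fstL 2 ℂ (L2 P) ℂ).continuous

lemma F_mem_radialY {ubar : X P} {p : XC P} (hp : p ∈ radialX P) : F ubar p ∈ radialY P :=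
  Submodule.sub_mem _ (opL_mem_radialL2 hp) (Submodule.smul_mem _ _ hp)

lemma bilPart_mem_radialY {p : XC P} (hp : p ∈ radialX P) : bilPart p p ∈ radialY P :=
  Submodule.neg_mem _ (Submodule.add_mem _ (Submodule.smul_mem _ _ hp) (Submodule.smul_mem _ _ hp))

/-! ### Solvability of the linearised equation -/

lemma memLp_comp_fst {v : ℝ → ℂ} (hv : MemLp v 2 P.ν) :
    MemLp (fun x : ℝ × ℝ => v x.1) 2 P.μ :=
  hv.comp_measurePreserving measurePreserving_radius

/-- A solution of the radial equation which vanishes at `rmax` gives an element of `X`. -/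
lemma IsRadialSolution.exists_X {lam c : ℂ} {w u v q : ℝ → ℂ}
    (h : IsRadialSolution P lam w c u v q) (hb : u P.rmax = 0) :
    ∃ U : X P, (X.toL2 P U =ᵐ[P.μ] fun x => u x.1) ∧
      (opL U - lam • X.toL2 P U : L2 P) =ᵐ[P.μ] fun x => w x.1 := by
  have hab := P.rmin_lt_rmax.le
  have hu := memLp_comp_fst (memLp_ν_of_continuousOn (P := P) h.continuous_u.continuousOn)
  have hv := memLp_comp_fst (memLp_ν_of_continuousOn (P := P) h.continuous_v.continuousOn)
  have hq := memLp_comp_fst h.memLp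
  have hur := mem_radialL2_of_ae_eq hu.coeFn_toLp
  have hvr := mem_radialL2_of_ae_eq hv.coeFn_toLp
  have d1 : IsWeakDeriv er (hu.toLp _) (hv.toLp _) :=
    isWeakDeriv_radius_of_eq_integral hu.coeFn_toLp hv.coeFn_toLp fun η h1 h2 h3 =>
      integral_mul_deriv_of_eq_integral hab (h.continuous_v.intervalIntegrable _ _) (c := 0)
        (fun t ht => by rw [zero_add]; exact h.eq_u t ht) h1 h2 h3
  have d2 : IsWeakDeriv er (hv.toLp _) (hq.toLp _) :=
    isWeakDeriv_radius_of_eq_integral hv.coeFn_toLp hq.coeFn_toLp fun η h1 h2 h3 =>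
      integral_mul_deriv_of_eq_integral hab
        (intervalIntegrable_of_memLp h.memLp ⟨hab, le_rfl⟩) h.eq_v h1 h2 h3
  have e1 := isWeakDeriv_angle_of_mem_radialL2 hur
  have e2 := isWeakDeriv_angle_of_mem_radialL2 hvr
  have hX : hu.toLp _ ∈ XSubmodule P := by
    refine ⟨⟨⟨⟨_, d1⟩, ⟨_, e1⟩⟩, ?_, ?_⟩, fun x => u x.1, ?_, hu.coeFn_toLp, ?_, fun _ _ => rfl⟩
    · rw [d1.wderiv_eq]
      exact ⟨⟨_, d2⟩, ⟨_, e2⟩⟩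
    · rw [e1.wderiv_eq]
      exact memH1_zero
    · exact (h.continuous_u.comp continuous_fst).continuousOn
    · intro ψ _
      refine ⟨?_, hb⟩
      change u P.rmin = 0
      rw [h.eq_u P.rmin ⟨le_rfl, hab⟩, intervalIntegral.integral_same]
  let U : X P := ⟨_, hX⟩
  have f1 : X.toL2 P U = hu.toLp _ := rfl
  have f2 : X.dr U = hv.toLp _ := d1.wderiv_eq
  have f3 : X.drr U = hq.toLp _ := by
    change wderiv er (X.dr U) = _
    rw [f2, d2.wderiv_eq]
  refine ⟨U, hu.coeFn_toLp, ?_⟩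
  rw [opL_of_radial (f1 ▸ hur), f1, f2, f3]
  filter_upwards [Lp.coeFn_sub (((P.σ ^ 2 / 2 : ℝ) : ℂ) • hq.toLp _
      + mulL2 P.f P.continuousOn_f (hv.toLp _)) (lam • hu.toLp _),
    Lp.coeFn_add (((P.σ ^ 2 / 2 : ℝ) : ℂ) • hq.toLp _) (mulL2 P.f P.continuousOn_f (hv.toLp _)),
    Lp.coeFn_smul ((P.σ ^ 2 / 2 : ℝ) : ℂ) (hq.toLp _), Lp.coeFn_smul lam (hu.toLp _),
    coeFn_mulL2 P.continuousOn_f (hv.toLp _), hu.coeFn_toLp, hv.coeFn_toLp, hq.coeFn_toLp,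
    P.ae_mem] with x a1 a2 a3 a4 a5 a6 a7 a8 hx
  rw [a1, Pi.sub_apply, a2, Pi.add_apply, a3, Pi.smul_apply, a4, Pi.smul_apply, a5, a6, a7, a8,
    smul_eq_mul, smul_eq_mul]
  exact h.eqn x.1 (Ioo_subset_Icc_self hx.1)

lemma fderiv_F_apply (ubar : X P) (p h : XC P) : fderiv ℂ (F ubar) p h
    = WithLp.toLp 2 (opL h.fst - p.snd • X.toL2 P h.fst - h.snd • X.toL2 P p.fst,
      inner ℂ (X.toL2 P ubar) (X.toL2 P h.fst)) := by
  rw [fderiv_F]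
  change linPart ubar h + bilPart p h = _
  rw [linPart_apply, bilPart_apply, ← WithLp.toLp_add]
  congr 1
  refine Prod.ext ?_ (add_zero _)
  simp only [Prod.fst_add]
  abel

/-- If the derivative of `F` at a radial point is injective, it maps the radial pairs onto the
radial pairs: the initial slope and the eigenvalue solve a linear system of two equations. -/
lemma exists_fderiv_F_eq {pbar : XC P} (hpbar : pbar ∈ radialX P)
    (hinj : ∀ p, fderiv ℂ (F pbar.fst) pbar p = 0 → p = 0) {z : YC P} (hz : z ∈ radialY P) :
    ∃ p ∈ radialX P, fderiv ℂ (F pbar.fst) pbar p = z := by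
  set ubar := X.toL2 P pbar.fst with hubar
  set lam : ℂ := pbar.snd with hlam
  obtain ⟨b, hbL, hb⟩ := exists_memLp_of_mem_radialL2 (mem_radialX.1 hpbar)
  obtain ⟨w, hwL, hw⟩ := exists_memLp_of_mem_radialL2 (mem_radialY.1 hz)
  -- Building blocks with value zero at `rmin`: `u₀` carries the right-hand side `w`, `u₁` the free
  -- initial slope, and `u₂` the forcing by `ū` from the increment of `λ`.
  obtain ⟨u₀, v₀, q₀, h₀⟩ := exists_isRadialSolution lam hwL 0
  obtain ⟨u₁, v₁, q₁, h₁⟩ := exists_isRadialSolution (P := P) lam (w := fun _ => 0)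
    (memLp_const _) 1
  obtain ⟨u₂, v₂, q₂, h₂⟩ := exists_isRadialSolution lam hbL 0
  have m₀ := memLp_comp_fst (memLp_ν_of_continuousOn (P := P) h₀.continuous_u.continuousOn)
  have m₁ := memLp_comp_fst (memLp_ν_of_continuousOn (P := P) h₁.continuous_u.continuousOn)
  have m₂ := memLp_comp_fst (memLp_ν_of_continuousOn (P := P) h₂.continuous_u.continuousOn)
  set i₀ : ℂ := inner ℂ ubar (m₀.toLp _) with hi₀
  set i₁ : ℂ := inner ℂ ubar (m₁.toLp _) with hi₁
  set i₂ : ℂ := inner ℂ ubar (m₂.toLp _) with hi₂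
  have key : ∀ s c l : ℂ, s * u₀ P.rmax + (c * u₁ P.rmax + l * u₂ P.rmax) = 0 →
      ∃ U : X P, (X.toL2 P U =ᵐ[P.μ] fun x => s * u₀ x.1 + (c * u₁ x.1 + l * u₂ x.1)) ∧
        opL U - lam • X.toL2 P U - l • ubar = s • z.fst ∧
        inner ℂ ubar (X.toL2 P U) = s * i₀ + (c * i₁ + l * i₂) := by
    intro s c l h0
    obtain ⟨U, hU, hU'⟩ := IsRadialSolution.exists_X
      ((h₀.const_mul s).add ((h₁.const_mul c).add (h₂.const_mul l))) h0
    refine ⟨U, hU, Lp.ext ?_, ?_⟩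
    · filter_upwards [hU', Lp.coeFn_sub (opL U - lam • X.toL2 P U) (l • ubar),
        Lp.coeFn_smul l ubar, Lp.coeFn_smul s z.fst, hb, hw] with x a1 a2 a3 a4 a5 a6
      rw [a2, Pi.sub_apply, a1, a3, a4, Pi.smul_apply, Pi.smul_apply, a5, a6, smul_eq_mul,
        smul_eq_mul]
      ring
    · have : X.toL2 P U = s • m₀.toLp _ + (c • m₁.toLp _ + l • m₂.toLp _) := by
        refine Lp.ext ?_
        filter_upwards [hU, Lp.coeFn_add (s • m₀.toLp _) (c • m₁.toLp _ + l • m₂.toLp _),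
          Lp.coeFn_add (c • m₁.toLp _) (l • m₂.toLp _), Lp.coeFn_smul s (m₀.toLp _),
          Lp.coeFn_smul c (m₁.toLp _), Lp.coeFn_smul l (m₂.toLp _), m₀.coeFn_toLp,
          m₁.coeFn_toLp, m₂.coeFn_toLp] with x a1 a2 a3 a4 a5 a6 a7 a8 a9
        rw [a1, a2, Pi.add_apply, a3, Pi.add_apply, a4, a5, a6, Pi.smul_apply, Pi.smul_apply,
          Pi.smul_apply, a7, a8, a9]
        rfl
      rw [this, inner_add_right, inner_add_right, inner_smul_right, inner_smul_right,
        inner_smul_right]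
  -- The first row is the boundary value at `rmax`, the second the pairing with `ū`; the unknowns
  -- are the slope `c` and the increment `l` of the eigenvalue.
  let Φ : ℂ × ℂ →ₗ[ℂ] ℂ × ℂ :=
    ((u₁ P.rmax) • LinearMap.fst ℂ ℂ ℂ + (u₂ P.rmax) • LinearMap.snd ℂ ℂ ℂ).prod
      (i₁ • LinearMap.fst ℂ ℂ ℂ + i₂ • LinearMap.snd ℂ ℂ ℂ)
  have hΦ : ∀ x, Φ x = (x.1 * u₁ P.rmax + x.2 * u₂ P.rmax, x.1 * i₁ + x.2 * i₂) := by
    intro x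
    simp [Φ, mul_comm]
  have hΦinj : Function.Injective Φ := by
    rw [← LinearMap.ker_eq_bot, LinearMap.ker_eq_bot']
    rintro ⟨c, l⟩ hx
    rw [hΦ, Prod.mk_eq_zero] at hx
    obtain ⟨U, hU, hU1, hU2⟩ := key 0 c l (by rw [zero_mul, zero_add]; exact hx.1)
    -- A kernel vector of `Φ` produces a kernel element of `F'(p̄)`. Its vanishing gives `l = 0` and
    -- then `c u₁ = 0` almost everywhere, whose initial slope is `c`.
    have hp : (WithLp.toLp 2 (U, l) : XC P) = 0 := by
      refine hinj _ ?_
      rw [fderiv_F_apply]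
      change WithLp.toLp 2 (opL U - lam • X.toL2 P U - l • ubar, inner ℂ ubar (X.toL2 P U)) = 0
      rw [hU1, hU2, hx.2, zero_smul, zero_mul, zero_add]
      rfl
    have hl : l = 0 := congrArg WithLp.snd hp
    have hU0 : U = 0 := congrArg WithLp.fst hp
    have h1 := h₁.const_mul c
    rw [mul_one] at h1
    have hc : c = 0 := by
      refine h1.slope_eq_zero ?_
      have hm : MeasurableSet {t | c * u₁ t = (0 : ℝ → ℂ) t} :=
        (isClosed_eq h1.continuous_u continuous_const).measurableSet
      refine (ae_map_iff measurable_fst.aemeasurable hm).2 ?_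
      rw [hU0, map_zero] at hU
      filter_upwards [hU, Lp.coeFn_zero ℂ 2 P.μ] with x a1 a2
      rw [a2, hl, zero_mul, zero_mul, zero_add, add_zero] at a1
      exact a1.symm
    rw [hc, hl]
    rfl
  obtain ⟨⟨c, l⟩, hcl⟩ := LinearMap.surjective_of_injective hΦinj (-u₀ P.rmax, z.snd - i₀)
  rw [hΦ, Prod.mk.injEq] at hcl
  obtain ⟨U, hU, hU1, hU2⟩ := key 1 c l (by rw [hcl.1]; ring)
  refine ⟨WithLp.toLp 2 (U, l), mem_radialL2_of_ae_eq
    (v := fun r => 1 * u₀ r + (c * u₁ r + l * u₂ r)) hU, ?_⟩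
  rw [fderiv_F_apply]
  change WithLp.toLp 2 (opL U - lam • X.toL2 P U - l • ubar, inner ℂ ubar (X.toL2 P U)) = z
  rw [hU1, hU2, hcl.2, one_smul, one_mul, add_sub_cancel]
  rfl

end ShearHopf

/-! ### Existence, uniqueness and radial symmetry of the zero -/

theorem corollary3p2 (P : ShearHopf.Params) (pbar : ShearHopf.XC P) (δ κ γ : ℝ)
    (hδ0 : 0 ≤ δ) (hκ0 : 0 ≤ κ) (hγ0 : 0 ≤ γ)
    (hδ : ‖ShearHopf.F pbar.fst pbar‖ ≤ δ)
    (hκ : ∀ p : ShearHopf.XC P, ‖p‖ ≤ κ * ‖fderiv ℂ (ShearHopf.F pbar.fst) pbar p‖)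
    (hγ : ∀ p q : ShearHopf.XC P,
      ‖fderiv ℂ (fderiv ℂ (ShearHopf.F pbar.fst)) pbar p q‖ ≤ γ * ‖p‖ * ‖q‖)
    (hcond : 2 * κ ^ 2 * γ * δ < 1)
    (hrad : ShearHopf.IsRadial (ShearHopf.X.toL2 P pbar.fst))
    (ρ : ℝ) (hρ1 : (1 - √(1 - 2 * κ ^ 2 * γ * δ)) / (κ * γ) ≤ ρ) (hρ2 : ρ < 1 / (κ * γ)) :
    (∃! p : ShearHopf.XC P, ShearHopf.F pbar.fst p = 0 ∧ ‖p - pbar‖ ≤ ρ) ∧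
      ∀ p : ShearHopf.XC P, ShearHopf.F pbar.fst p = 0 → ‖p - pbar‖ ≤ ρ →
        ShearHopf.IsRadial (ShearHopf.X.toL2 P p.fst) := by
  open ShearHopf in
  rw [fderiv_fderiv_F] at hγ
  -- If `κγ = 0`, both quotients are zero by the convention for division by zero, and the bounds on
  -- `ρ` would read `0 ≤ ρ < 0`.
  have hκγ : 0 < κ * γ := by
    rcases (mul_nonneg hκ0 hγ0).eq_or_lt with h | h
    · rw [← h, div_zero] at hρ1 hρ2
      exact absurd (hρ1.trans_lt hρ2) (lt_irrefl _)
    · exact h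
  have hκp : 0 < κ := pos_of_mul_pos_left hκγ hγ0
  have hγp : 0 < γ := pos_of_mul_pos_right hκγ hκ0
  have hρ : κ * γ * ρ < 1 := by
    rw [lt_div_iff₀ hκγ] at hρ2
    linarith
  set A := fderiv ℂ (F pbar.fst) pbar with hA
  have hpbar : pbar ∈ radialX P := mem_radialX.2 (mem_radialL2_iff.2 hrad)
  have hinj : ∀ p, A p = 0 → p = 0 := fun p hp => by
    have := hκ p
    rw [hp, norm_zero, mul_zero] at this
    exact norm_le_zero_iff.1 this
  obtain ⟨h, hh, hh0, hhr⟩ := exists_quadratic_zero A bilPart bilPart_symm (radialX P) (radialY P)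
    isClosed_radialY (F_mem_radialY hpbar) (fun p hp => bilPart_mem_radialY hp)
    (fun z hz => exists_fderiv_F_eq hpbar hinj hz) hκp hγp hκ hγ hδ hcond
  -- The comparison is with all zeros in the ball, radial or not; this is what forces every such
  -- zero to be radial.
  have huniq : ∀ p, F pbar.fst p = 0 → ‖p - pbar‖ ≤ ρ → p = pbar + h := by
    intro p hp hpρ
    have h1 := F_add pbar.fst pbar (p - pbar)
    rw [add_sub_cancel, hp] at h1
    rw [← eq_of_quadratic_zero A bilPart bilPart_symm hκ0 hγ0 hκ hγ hρ h1.symm hh0 hpρ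
      (hhr.trans hρ1), add_sub_cancel]
  refine ⟨⟨pbar + h, ⟨?_, ?_⟩, fun p hp => huniq p hp.1 hp.2⟩, fun p hp hpρ => ?_⟩
  · rw [F_add]
    exact hh0
  · rw [add_sub_cancel_left]
    exact hhr.trans hρ1
  · rw [huniq p hp hpρ]
    exact mem_radialL2_iff.1 (mem_radialX.1 (Submodule.add_mem _ hpbar hh))
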